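/- Let $n_r\ge n_t\ge 1$ and $q=\sqrt M=2^k$ with $k\ge 1$. Information symbols $\mathbf s\in\{0,\dots,q-1\}^{2n_t}$ are centred, $\mathbf s'=\mathbf s-\frac{q-1}{2}\mathbf 1$, and sent uncoded (V-BLAST): $x_i=s'_i+\imath s'_{n_t+i}$ for $1\le i\le n_t$. The received vector is $\mathbf Y=\sqrt{P/n_t}\,\mathbf H\mathbf x+\mathbf Z$, where $\mathbf H\in\mathbb C^{n_r\times n_t}$ and $\mathbf Z\in\mathbb C^{n_r}$ are independent with i.i.d. $\mathcal N_c(0,1)$ entries; the receiver knows $\mathbf H$ and uses the real vector $\mathbf y=\sqrt{n_t/P}\,(\mathrm{Re}\,\mathbf Y,\mathrm{Im}\,\mathbf Y)=\mathcal H\mathbf s'+\sqrt{n_t/P}\,\mathbf z$ with $\mathbf z=(\mathrm{Re}\,\mathbf Z,\mathrm{Im}\,\mathbf Z)$ and $\mathcal H=\begin{pmatrix}\mathrm{Re}\,\mathbf H&-\mathrm{Im}\,\mathbf H\\ \mathrm{Im}\,\mathbf H&\mathrm{Re}\,\mathbf H\end{pmatrix}$. For an integer row $\mathbf a$ and a real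 row $\mathbf b$ put $g(\mathbf a,\mathbf b)=\|\mathbf b\mathcal H-\mathbf a\|^2\bar E+\frac{n_t}{2P}\|\mathbf b\|^2$, where $\bar E$ is the average energy of the centred constellation. The integer-forcing (IF) linear receiver uses, as (measurable) functions of $P$ and $\mathbf H$, matrices $\mathbf A\in\mathbb Z^{2n_t\times 2n_t}$, invertible over $\mathbb Z/q$, and $\mathbf B\in\mathbb R^{2n_t\times 2n_r}$ with rows $\mathbf a_m,\mathbf b_m$, that minimize $\max_m g(\mathbf a_m,\mathbf b_m)$ among all such pairs. It computes $\hat{\mathbf y}=\lfloor\mathbf B\mathbf y+\frac{q-1}{2}\mathbf A\mathbf 1\rceil$ componentwise and outputs the solution $\hat{\mathbf s}$ of $\mathbf A\hat{\mathbf s}=\hat{\mathbf y}$ over $\mathbb Z/q$. Let $P_e(m)=\Pr(\hat y_m\ne(\mathbf A\mathbf s)_m)$, averaged over $\mathbf H$ and $\mathbf Z$. Then the IF receiver provides full receive diversity: for every transmitted $\mathbf s$, $\Pr(\hat{\mathbf y}\ne\mathbf A\mathbf s)$ and $\Pr(\hat{\mathbf s}\ne\mathbf s)$ are at most $C/P^{n_r}$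 for all large $P$, with $C$ independent of $P$. More precisely, there are constants $c,P_0>0$, depending only on $n_t$ and $M$, such that for all $n_r\ge n_t$, all $P\ge P_0$, every IF receiver, every transmitted $\mathbf s$ and every layer $1\le m\le 2n_t$, $$P_e(m)\le\Big(\frac1{1+cP}\Big)^{n_r}.$$ If $n_r>n_t$ or $n_t=n_r=1$ is required, then $c$ and $P_0$ can be chosen depending only on $n_t$, not on $M$. -/

import Mathlib

open MeasureTheory ProbabilityTheory Matrix
open scoped ENNReal

noncomputable section

namespace VBLAST

/-- Index set of the `2n` real coordinates of a vector of `ℂⁿ`: real parts first, then imaginary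
parts. -/
abbrev RealIdx (n : ℕ) : Type := Fin n ⊕ Fin n

/-- Vectorization `ℂⁿ → ℝ²ⁿ`. -/
def realVec {n : ℕ} (v : Fin n → ℂ) : RealIdx n → ℝ :=
  Sum.elim (fun i => (v i).re) (fun i => (v i).im)

/-- The real form `[[Re H, -Im H], [Im H, Re H]]` of a complex channel matrix. -/
def realChannel {nt nr : ℕ} (H : Matrix (Fin nr) (Fin nt) ℂ) :
    Matrix (RealIdx nr) (RealIdx nt) ℝ :=
  Matrix.fromBlocks (H.map Complex.re) (-(H.map Complex.im)) (H.map Complex.im) (H.map Complex.re)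

/-- The circularly symmetric complex Gaussian law with mean zero and unit variance: independent
real and imaginary parts of variance `1/2` each. -/
def complexGaussian : Measure ℂ :=
  ((gaussianReal 0 (1 / 2)).prod (gaussianReal 0 (1 / 2))).map (fun p : ℝ × ℝ => (⟨p.1, p.2⟩ : ℂ))

/-- Law of the additive noise vector: i.i.d. standard complex Gaussian entries. -/
def noiseLaw (nr : ℕ) : Measure (Fin nr → ℂ) :=
  Measure.pi fun _ => complexGaussian

/-- Complex matrices carry the product sigma-algebra of their entries. -/
instance matrixMeasurableSpace (nt nr : ℕ) : MeasurableSpace (Matrix (Fin nr) (Fin nt) ℂ) :=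
  inferInstanceAs (MeasurableSpace (Fin nr → Fin nt → ℂ))

/-- Law of the Rayleigh fading channel matrix: i.i.d. standard complex Gaussian entries. -/
def channelLaw (nt nr : ℕ) : Measure (Matrix (Fin nr) (Fin nt) ℂ) :=
  Measure.pi fun _ => Measure.pi fun _ => complexGaussian

/-- Information symbols: `2 nt` elements of the constellation `{0, …, q - 1}` (with `q = √M`). -/
abbrev Symbols (nt q : ℕ) : Type := RealIdx nt → Fin q

/-- The shift that centres the constellation `{0, …, q - 1}` at the origin. -/
def centre (q : ℕ) : ℝ := ((q : ℝ) - 1) / 2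

/-- Average energy of the centred constellation. -/
def avgEnergy (q : ℕ) : ℝ := (∑ a : Fin q, (((a : ℕ) : ℝ) - centre q) ^ 2) / q

/-- The centred real symbols. -/
def centred {nt q : ℕ} (s : Symbols nt q) : RealIdx nt → ℝ :=
  fun k => (((s k : Fin q) : ℕ) : ℝ) - centre q

/-- The transmitted uncoded vector: antenna `i` sends one (centred) real symbol on its real part
and one on its imaginary part. -/
def codeword {nt q : ℕ} (s : Symbols nt q) : Fin nt → ℂ :=
  fun i => ⟨centred s (Sum.inl i), centred s (Sum.inr i)⟩

/-- The received vector `Y = √(P / nt) H x + Z`. -/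
def received {nt nr q : ℕ} (P : ℝ) (H : Matrix (Fin nr) (Fin nt) ℂ) (s : Symbols nt q)
    (Z : Fin nr → ℂ) : Fin nr → ℂ :=
  fun j => ((Real.sqrt (P / nt) : ℝ) : ℂ) * (H *ᵥ codeword s) j + Z j

/-- The vectorized and rescaled received vector, the input of the linear receiver. -/
def observation {nt nr q : ℕ} (P : ℝ) (H : Matrix (Fin nr) (Fin nt) ℂ) (s : Symbols nt q)
    (Z : Fin nr → ℂ) : RealIdx nr → ℝ :=
  Real.sqrt ((nt : ℝ) / P) • realVec (received P H s Z)

/-- Effective noise power `‖b 𝓗 - a‖² Ē + (nt / (2P)) ‖b‖²` of a layer with integer coefficient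
row `a` and filter row `b`. -/
def effectiveNoise {nt nr : ℕ} (q : ℕ) (P : ℝ) (H : Matrix (Fin nr) (Fin nt) ℂ)
    (a : RealIdx nt → ℤ) (b : RealIdx nr → ℝ) : ℝ :=
  (∑ k, ((b ᵥ* realChannel H) k - (a k : ℝ)) ^ 2) * avgEnergy q
    + (nt : ℝ) / (2 * P) * ∑ j, b j ^ 2

/-- The reduction of an integer matrix to the ring `ℤ/q` of the constellation. -/
def modMatrix {nt : ℕ} (q : ℕ) (A : Matrix (RealIdx nt) (RealIdx nt) ℤ) :
    Matrix (RealIdx nt) (RealIdx nt) (ZMod q) :=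
  A.map (Int.cast : ℤ → ZMod q)

/-- `(A, B)` is an optimal pair for the channel `H`: `A` is invertible over the ring of the
constellation, and the largest effective noise power among the layers is minimal among all pairs
whose integer matrix is invertible over that ring. -/
def IsOptimalPair {nt nr : ℕ} (q : ℕ) (P : ℝ) (H : Matrix (Fin nr) (Fin nt) ℂ)
    (A : Matrix (RealIdx nt) (RealIdx nt) ℤ) (B : Matrix (RealIdx nt) (RealIdx nr) ℝ) : Prop :=
  IsUnit (modMatrix q A) ∧
    ∀ (A' : Matrix (RealIdx nt) (RealIdx nt) ℤ) (B' : Matrix (RealIdx nt) (RealIdx nr) ℝ),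
      IsUnit (modMatrix q A') →
        ∀ m, ∃ m', effectiveNoise q P H (A m) (B m) ≤ effectiveNoise q P H (A' m') (B' m')

/-- A (measurable) rule that selects the integer matrix and the filter matrix from the power and
the channel, which the receiver knows. -/
structure Receiver (nt nr : ℕ) where
  A : ℝ → Matrix (Fin nr) (Fin nt) ℂ → Matrix (RealIdx nt) (RealIdx nt) ℤ
  B : ℝ → Matrix (Fin nr) (Fin nt) ℂ → Matrix (RealIdx nt) (RealIdx nr) ℝ
  measurable_A : ∀ P m k, Measurable fun H => A P H m k
  measurable_B : ∀ P m j, Measurable fun H => B P H m j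

namespace Receiver

variable {nt nr : ℕ}

/-- The integer-forcing linear receiver for the constellation `{0, …, q - 1}`: at every power, it
uses an optimal pair for almost every channel. -/
def IsIntegerForcing (rx : Receiver nt nr) (q : ℕ) : Prop :=
  ∀ P : ℝ, 0 < P → ∀ᵐ H ∂(channelLaw nt nr), IsOptimalPair q P H (rx.A P H) (rx.B P H)

/-- Output of the filter, with the centring of the symbols reverted. -/
def filtered (rx : Receiver nt nr) {q : ℕ} (P : ℝ) (H : Matrix (Fin nr) (Fin nt) ℂ)
    (s : Symbols nt q) (Z : Fin nr → ℂ) : RealIdx nt → ℝ :=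
  fun m => (rx.B P H *ᵥ observation P H s Z) m + ∑ k, (rx.A P H m k : ℝ) * centre q

/-- Step 1: every layer is decoded to the nearest integer. -/
def latticeOutput (rx : Receiver nt nr) {q : ℕ} (P : ℝ) (H : Matrix (Fin nr) (Fin nt) ℂ)
    (s : Symbols nt q) (Z : Fin nr → ℂ) : RealIdx nt → ℤ :=
  fun m => round (rx.filtered P H s Z m)

/-- The noiseless value `A s` that Step 1 has to recover. -/
def target (rx : Receiver nt nr) {q : ℕ} (P : ℝ) (H : Matrix (Fin nr) (Fin nt) ℂ)
    (s : Symbols nt q) : RealIdx nt → ℤ :=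
  rx.A P H *ᵥ fun k => ((s k : ℕ) : ℤ)

/-- Steps 2 and 3: reduce modulo `q` and solve the linear system over `ℤ/q`. -/
def decoded (rx : Receiver nt nr) {q : ℕ} (P : ℝ) (H : Matrix (Fin nr) (Fin nt) ℂ)
    (s : Symbols nt q) (Z : Fin nr → ℂ) : RealIdx nt → ZMod q :=
  (modMatrix q (rx.A P H))⁻¹ *ᵥ fun m => (rx.latticeOutput P H s Z m : ZMod q)

/-- Error probability of layer `m` in Step 1, averaged over the channel, when `s` is sent. -/
def layerError (rx : Receiver nt nr) {q : ℕ} (s : Symbols nt q) (m : RealIdx nt) (P : ℝ) : ℝ≥0∞ :=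
  ∫⁻ H, noiseLaw nr {Z | rx.latticeOutput P H s Z m ≠ rx.target P H s m} ∂(channelLaw nt nr)

/-- Error probability of Step 1 (some layer is in error), averaged over the channel, when `s` is
sent. -/
def latticeError (rx : Receiver nt nr) {q : ℕ} (s : Symbols nt q) (P : ℝ) : ℝ≥0∞ :=
  ∫⁻ H, noiseLaw nr {Z | rx.latticeOutput P H s Z ≠ rx.target P H s} ∂(channelLaw nt nr)

/-- Error probability of the whole receiver, averaged over the channel, when `s` is sent. -/
def symbolError (rx : Receiver nt nr) {q : ℕ} (s : Symbols nt q) (P : ℝ) : ℝ≥0∞ :=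
  ∫⁻ H, noiseLaw nr {Z | rx.decoded P H s Z ≠ fun k => ((s k : ℕ) : ZMod q)} ∂(channelLaw nt nr)

/-- For all powers `P ≥ P₀`, every layer has average error probability at most
`(1 / (1 + c P)) ^ nr`, whatever symbols are sent. -/
def LayerBound (rx : Receiver nt nr) (q : ℕ) (c P₀ : ℝ) : Prop :=
  ∀ P : ℝ, P₀ ≤ P → ∀ (s : Symbols nt q) (m : RealIdx nt),
    rx.layerError s m P ≤ ENNReal.ofReal ((1 / (1 + c * P)) ^ nr)

end Receiver

/-- An error probability, as a function of the power, has diversity (at least) `d` if it is at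
most `C / P ^ d` for all large powers `P`. -/
def HasDiversity (pe : ℝ → ℝ≥0∞) (d : ℕ) : Prop :=
  ∃ C P₀ : ℝ, 0 < C ∧ 0 < P₀ ∧ ∀ P : ℝ, P₀ ≤ P → pe P ≤ ENNReal.ofReal (C / P ^ d)

end VBLAST

end

/-! For a fixed channel, `T x = (x / √Ē, √(2P/nt) 𝓗 x)` embeds `ℤ^(2nt)` as a lattice. If an integer
row `a` is the functional `x ↦ ⟪u, T x⟫`, then the second block of `u`, rescaled, is a filter row
with effective noise exactly `‖u‖²`. Optimal noise is therefore governed by short bases of the dual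
lattice. A transference bound supplies a unimodular `A` whose dual vectors satisfy `‖u m‖ λ₁ ≤
K(nt)`, where `λ₁ = ‖T d‖` for a shortest vector `T d`; unimodular matrices are invertible modulo
every `q`, so optimality gives noise at most `K² / λ₁²` in every layer.

A Chernoff bound turns this into a conditional error probability at most `3 exp(-κ‖d‖²/Ē) exp(-κP‖𝓗
d‖²)`. The vector `d` depends on the channel, so it is replaced by the sum over all nonzero integer
vectors. For fixed `d`, averaging over Rayleigh fading gives `(1 + κP‖d‖²)^(-nr)`, which carries the
diversity order.

It remains to sum over `d`. The exponential in `‖d‖²/Ē` always gives convergence, with a constant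
depending on the constellation. For `nr > nt` the fading factor alone decays like `‖d‖^(-2nr)`,
which is summable on `ℤ^(2nt)`. For `nt = nr = 1` the channel is a scaled rotation, so `‖𝓗 d‖ ≥ |h|`
and no sum is needed. -/

/-! ### Lattice bases with short dual vectors -/

/-- A lattice of positive rank has a shortest nonzero vector. -/
theorem ZLattice.exists_shortest {E : Type*} [NormedAddCommGroup E] [InnerProductSpace ℝ E]
    [FiniteDimensional ℝ E] (L : Submodule ℤ E) [DiscreteTopology L] (hL : L ≠ ⊥) :
    ∃ v ∈ L, v ≠ 0 ∧ ∀ x ∈ L, x ≠ 0 → ‖v‖ ≤ ‖x‖ := by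
  obtain ⟨x₀, hx₀, hx₀'⟩ := Submodule.exists_mem_ne_zero_of_ne_bot hL
  have hfin : (Metric.closedBall (0 : E) ‖x₀‖ ∩ (L : Set E)).Finite := by
    change (Metric.closedBall (0 : E) ‖x₀‖ ∩ (L.toAddSubgroup : Set E)).Finite
    have : DiscreteTopology L.toAddSubgroup := (inferInstance : DiscreteTopology L)
    exact Metric.finite_isBounded_inter_isClosed
      DiscreteTopology.isDiscrete Metric.isBounded_closedBall inferInstance
  obtain ⟨v, ⟨⟨hv1, hv2⟩, hv3⟩, hv⟩ := Set.exists_min_image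
    ((Metric.closedBall (0 : E) ‖x₀‖ ∩ (L : Set E)) \ {0}) (fun x => ‖x‖) hfin.sdiff
    ⟨x₀, ⟨by simp, hx₀⟩, by simpa using hx₀'⟩
  refine ⟨v, hv2, by simpa using hv3, fun x hx hx0 => ?_⟩
  by_cases h : ‖x‖ ≤ ‖x₀‖
  · exact hv x ⟨⟨by simpa using h, hx⟩, by simpa using hx0⟩
  · exact le_trans (by simpa using hv1) (not_le.1 h).le

/-- Size-reduced lifting: a family of lattice vectors whose projections along a shortest vector `v`
span the projected lattice generates the lattice together with `v`. -/
theorem ZLattice.span_cons_eq {E : Type*} [NormedAddCommGroup E] [InnerProductSpace ℝ E]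
    [FiniteDimensional ℝ E] {n : ℕ} (L : Submodule ℤ E) (v : E) (hvL : v ∈ L) (hv0 : v ≠ 0)
    (hv : ∀ x ∈ L, x ≠ 0 → ‖v‖ ≤ ‖x‖) (w : Fin n → E) (hw : ∀ i, w i ∈ L)
    (hspan : ∀ x ∈ L, ∃ y ∈ Submodule.span ℤ (Set.range w), ∃ t : ℝ, x - y = t • v) :
    Submodule.span ℤ (Set.range (Fin.cons v w : Fin (n + 1) → E)) = L := by
  refine le_antisymm ?_ fun x hx => ?_
  · rw [Submodule.span_le]
    rintro _ ⟨i, rfl⟩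
    refine Fin.cases ?_ (fun i => ?_) i
    · simpa using hvL
    · simpa using hw i
  · obtain ⟨y, hy, t, ht⟩ := hspan x hx
    have hyL : y ∈ L := (Submodule.span_le.2 (by rintro _ ⟨i, rfl⟩; exact hw i)) hy
    have hvpos : 0 < ‖v‖ := norm_pos_iff.2 hv0
    -- The remainder is a lattice vector of length at most `‖v‖ / 2`, so minimality of `v` forces it
    -- to vanish.
    have hz : x - y - round t • v = 0 := by
      by_contra hne
      have h1 := hv _ (L.sub_mem (L.sub_mem hx hyL) (L.smul_mem (round t) hvL)) hne
      have h2 : x - y - round t • v = (t - round t) • v := by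
        rw [ht, sub_smul, Int.cast_smul_eq_zsmul]
      rw [h2, norm_smul, Real.norm_eq_abs] at h1
      nlinarith [abs_sub_round t]
    have hx' : x = y + round t • v := by rw [← sub_eq_zero, ← hz]; abel
    rw [hx']
    refine Submodule.add_mem _ ?_ (Submodule.smul_mem _ _ (Submodule.subset_span ⟨0, by simp⟩))
    exact Submodule.span_mono (by rintro _ ⟨i, rfl⟩; exact ⟨i.succ, by simp⟩) hy

open Module in
/-- Every lattice of rank `n` has a basis whose dual basis vectors are, up to a factor depending
only on `n`, at most as long as the inverse of the length of the shortest nonzero vector. -/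
theorem ZLattice.exists_basis_coord_le (n : ℕ) : ∃ K : ℝ, 0 < K ∧
    ∀ (E : Type) [NormedAddCommGroup E] [InnerProductSpace ℝ E] [FiniteDimensional ℝ E],
      finrank ℝ E = n → ∀ (L : Submodule ℤ E) [DiscreteTopology L] [IsZLattice ℝ L] (r : ℝ),
        (∀ x ∈ L, x ≠ 0 → r ≤ ‖x‖) → ∃ b : Basis (Fin n) ℝ E,
          Submodule.span ℤ (Set.range b) = L ∧ ∀ m x, r * |b.repr x m| ≤ K * ‖x‖ := by
  induction n with
  | zero =>
    refine ⟨1, one_pos, fun E _ _ _ hE L _ _ r _ => ?_⟩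
    have : Subsingleton E := finrank_zero_iff.1 hE
    exact ⟨basisOfFinrankZero hE, Subsingleton.elim _ _, fun m => m.elim0⟩
  | succ n ih =>
    obtain ⟨K, hK, ih⟩ := ih
    -- The coordinate on `v` costs `1 + n * K`, the others `2 * K`; the sum covers both.
    refine ⟨1 + 2 * K + n * K, by positivity, fun E _ _ _ hE L _ hLat r hr => ?_⟩
    have hLne : L ≠ ⊥ := by
      rintro rfl
      have h1 := hLat.span_top
      have : finrank ℝ (⊤ : Submodule ℝ E) = 0 := by rw [← h1]; simp
      rw [finrank_top] at this
      omega
    obtain ⟨v, hvL, hv0, hv⟩ := ZLattice.exists_shortest L hLne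
    have hvpos : 0 < ‖v‖ := norm_pos_iff.2 hv0
    set E' := (ℝ ∙ v)ᗮ with hE'
    let p : E →L[ℝ] E' := E'.orthogonalProjectionOnto
    let φ : E →ₗ[ℝ] ℝ := (‖v‖ ^ 2)⁻¹ • (innerₛₗ ℝ v)
    have hφ : ∀ x, φ x = inner ℝ v x / ‖v‖ ^ 2 := fun x => by
      simp [φ, div_eq_inv_mul]
    have hdec : ∀ x, x = φ x • v + (p x : E) := fun x => by
      have h1 := Submodule.starProjection_add_starProjection_orthogonal (K := (ℝ ∙ v)) x
      have h2 := Submodule.starProjection_singleton (𝕜 := ℝ) (v := v) x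
      rw [h2] at h1
      rw [hφ]
      exact h1.symm
    have hφv : φ v = 1 := by
      rw [hφ, real_inner_self_eq_norm_sq]; field_simp
    have hpv : p v = 0 := Submodule.orthogonalProjectionOnto_orthogonalComplement_singleton_eq_zero v
    have hpyth : ∀ x, ‖x‖ ^ 2 = φ x ^ 2 * ‖v‖ ^ 2 + ‖p x‖ ^ 2 := fun x => by
      have h := norm_add_sq_eq_norm_sq_add_norm_sq_of_inner_eq_zero (φ x • v) ((p x : E')  : E)
        (by rw [inner_smul_left,
          Submodule.mem_orthogonal_singleton_iff_inner_right.1 (p x).2, mul_zero])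
      rw [← hdec x, norm_smul, Real.norm_eq_abs] at h
      rw [sq, h, Submodule.coe_norm, ← sq_abs (φ x)]
      ring
    have hreduce : ∀ x ∈ L, ∃ y ∈ L, p y = p x ∧ |φ y| ≤ 1 / 2 := fun x hx => by
      refine ⟨x - round (φ x) • v, L.sub_mem hx (L.smul_mem _ hvL), ?_, ?_⟩
      · rw [map_sub, map_zsmul, hpv, smul_zero, sub_zero]
      · rw [map_sub, map_zsmul, hφv]
        simpa using abs_sub_round (φ x)
    -- A size-reduced lift has component at most `‖v‖ / 2` along `v` and length at least `‖v‖`, so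
    -- by Pythagoras its projection cannot be short. This makes the projected lattice discrete and
    -- feeds the induction.
    have hlow : ∀ x ∈ L, p x ≠ 0 → ‖v‖ / 2 ≤ ‖p x‖ := fun x hx hpx => by
      obtain ⟨y, hy, hyp, hyφ⟩ := hreduce x hx
      have hy0 : y ≠ 0 := by rintro rfl; exact hpx (by rw [← hyp, map_zero])
      have h1 := hv y hy hy0
      have h2 := hpyth y
      rw [hyp] at h2
      have h3 : φ y ^ 2 ≤ 1 / 4 := by
        rw [← sq_abs]; nlinarith [abs_nonneg (φ y)]
      nlinarith [norm_nonneg (p x), norm_nonneg y]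
    let L' : Submodule ℤ E' := L.map (p.toLinearMap.restrictScalars ℤ)
    have hL' : ∀ x ∈ L', x ≠ 0 → ‖v‖ / 2 ≤ ‖x‖ := by
      rintro _ ⟨x, hx, rfl⟩ hne
      exact hlow x hx hne
    have hdisc : DiscreteTopology L' := by
      refine DiscreteTopology.of_forall_le_dist (r := ‖v‖ / 2) (by positivity) fun x y hxy => ?_
      change ‖v‖ / 2 ≤ dist x y
      rw [Subtype.dist_eq, dist_eq_norm]
      exact hL' _ (L'.sub_mem x.2 y.2) (sub_ne_zero.2 fun h => hxy (Subtype.ext h))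
    have hlat' : IsZLattice ℝ L' := ⟨by
      have h1 : (L' : Set E') = p.toLinearMap '' (L : Set E) := rfl
      rw [h1, Submodule.span_image, hLat.span_top, Submodule.map_top, LinearMap.range_eq_top]
      exact fun y => ⟨y, Submodule.orthogonalProjectionOnto_mem_subspace_eq_self y⟩⟩
    have hfr : finrank ℝ E' = n := by
      have : Fact (finrank ℝ E = n + 1) := ⟨hE⟩
      exact Submodule.finrank_orthogonal_span_singleton hv0
    obtain ⟨b', hb'span, hb'⟩ := ih E' hfr L' (‖v‖ / 2) hL'
    have hlift : ∀ i, ∃ y ∈ L, p y = b' i ∧ |φ y| ≤ 1 / 2 := fun i => by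
      have : b' i ∈ L' := hb'span ▸ Submodule.subset_span ⟨i, rfl⟩
      obtain ⟨x, hx, hxi⟩ := this
      obtain ⟨y, hy, hyp, hyφ⟩ := hreduce x hx
      exact ⟨y, hy, hyp.trans hxi, hyφ⟩
    choose w hwL hwp hwφ using hlift
    have hspan : Submodule.span ℤ (Set.range (Fin.cons v w : Fin (n + 1) → E)) = L := by
      refine ZLattice.span_cons_eq L v hvL hv0 hv w hwL fun x hx => ?_
      have hpx : p x ∈ Submodule.span ℤ (Set.range b') := hb'span ▸ ⟨x, hx, rfl⟩
      obtain ⟨c, hc⟩ := (Submodule.mem_span_range_iff_exists_fun ℤ).1 hpx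
      refine ⟨∑ i, c i • w i, Submodule.sum_mem _ fun i _ => Submodule.smul_mem _ _
        (Submodule.subset_span ⟨i, rfl⟩), φ (x - ∑ i, c i • w i), ?_⟩
      have h0 : p (x - ∑ i, c i • w i) = 0 := by
        rw [map_sub, map_sum, ← hc]
        simp [hwp]
      conv_lhs => rw [hdec (x - ∑ i, c i • w i), h0]
      simp
    have htop : ⊤ ≤ Submodule.span ℝ (Set.range (Fin.cons v w : Fin (n + 1) → E)) := by
      rw [← hLat.span_top, Submodule.span_le, ← hspan]
      exact Submodule.span_le_restrictScalars ℤ ℝ _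
    let b : Basis (Fin (n + 1)) ℝ E :=
      basisOfTopLeSpanOfCardEqFinrank (Fin.cons v w) htop (by simp [hE])
    have hb : ⇑b = Fin.cons v w := by simp [b]
    refine ⟨b, by rw [hb, hspan], ?_⟩
    have hxsum : ∀ x, x = b.repr x 0 • v + ∑ i : Fin n, b.repr x i.succ • w i := fun x => by
      conv_lhs => rw [← b.sum_repr x]
      rw [Fin.sum_univ_succ, hb]
      simp
    have hsucc : ∀ x (i : Fin n), b.repr x i.succ = b'.repr (p x) i := fun x i => by
      have h1 : p x = ∑ i : Fin n, b.repr x i.succ • b' i := by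
        conv_lhs => rw [hxsum x]
        rw [map_add, map_smul, hpv, smul_zero, zero_add, map_sum]
        simp [hwp]
      rw [h1, b'.repr_sum_self]
    have hrv : r ≤ ‖v‖ := hr v hvL hv0
    have hpx : ∀ x, ‖p x‖ ≤ ‖x‖ := fun x =>
      Submodule.norm_orthogonalProjectionOnto_apply_le E' x
    have hcoord : ∀ x (i : Fin n), ‖v‖ * |b.repr x i.succ| ≤ 2 * K * ‖x‖ := fun x i => by
      have h1 := hb' i (p x)
      rw [hsucc]
      nlinarith [hpx x]
    have hφx : ∀ x, ‖v‖ * |φ x| ≤ ‖x‖ := fun x => by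
      refine abs_le_of_sq_le_sq' ?_ (norm_nonneg x) |>.2
      rw [mul_pow, sq_abs, hpyth x]
      nlinarith [sq_nonneg ‖p x‖]
    have hzero : ∀ x, ‖v‖ * |b.repr x 0| ≤ (1 + n * K) * ‖x‖ := fun x => by
      -- Apply `φ` to the expansion of `x`: size reduction bounds each correction `φ (w i)` by `1 /
      -- 2`.
      have h1 : b.repr x 0 = φ x - ∑ i : Fin n, b.repr x i.succ * φ (w i) := by
        have h := congrArg φ (hxsum x)
        simp only [map_add, map_sum, map_smul, hφv, smul_eq_mul, mul_one] at h
        linarith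
      have h2 : |b.repr x 0| ≤ |φ x| + ∑ i : Fin n, |b.repr x i.succ| * (1 / 2) := by
        rw [h1]
        refine (abs_sub _ _).trans (add_le_add le_rfl ?_)
        refine (Finset.abs_sum_le_sum_abs _ _).trans (Finset.sum_le_sum fun i _ => ?_)
        rw [abs_mul]
        exact mul_le_mul_of_nonneg_left (hwφ i) (abs_nonneg _)
      have h3 : ‖v‖ * ∑ i : Fin n, |b.repr x i.succ| * (1 / 2) ≤ n * (K * ‖x‖) := by
        rw [Finset.mul_sum]
        refine (Finset.sum_le_card_nsmul _ _ (K * ‖x‖) fun i _ => ?_).trans (by simp)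
        linarith [hcoord x i]
      calc ‖v‖ * |b.repr x 0| ≤ ‖v‖ * (|φ x| + ∑ i : Fin n, |b.repr x i.succ| * (1 / 2)) :=
            mul_le_mul_of_nonneg_left h2 hvpos.le
        _ ≤ (1 + n * K) * ‖x‖ := by rw [mul_add]; linarith [hφx x]
    intro m x
    refine (mul_le_mul_of_nonneg_right hrv (abs_nonneg _)).trans ?_
    refine Fin.cases ?_ (fun i => ?_) m
    · refine (hzero x).trans (mul_le_mul_of_nonneg_right ?_ (norm_nonneg x))
      linarith
    · refine (hcoord x i).trans (mul_le_mul_of_nonneg_right ?_ (norm_nonneg x))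
      nlinarith [mul_nonneg (Nat.cast_nonneg (α := ℝ) n) hK.le]

/-! ### Gaussian transforms and tails -/

namespace VBLAST

theorem measurable_complex_mk : Measurable fun p : ℝ × ℝ => (⟨p.1, p.2⟩ : ℂ) :=
  Complex.measurableEquivRealProd.symm.measurable

instance isProbabilityMeasure_complexGaussian : IsProbabilityMeasure complexGaussian :=
  Measure.isProbabilityMeasure_map measurable_complex_mk.aemeasurable

/-- The dependence on `‖t‖` alone expresses circular symmetry; it lets linear combinations be
identified by their total squared weight. -/
theorem charFun_complexGaussian (t : ℂ) :
    charFun complexGaussian t = Complex.exp (-(‖t‖ ^ 2 : ℝ) / 4) := by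
  have h1 := charFun_gaussianReal (μ := 0) (v := 1 / 2) t.re
  have h2 := charFun_gaussianReal (μ := 0) (v := 1 / 2) t.im
  rw [charFun_apply_real] at h1 h2
  rw [charFun_apply, complexGaussian, integral_map measurable_complex_mk.aemeasurable
    (by fun_prop)]
  have h3 : ∀ p : ℝ × ℝ, Complex.exp ((inner ℝ (⟨p.1, p.2⟩ : ℂ) t : ℝ) * Complex.I) =
      Complex.exp (t.re * p.1 * Complex.I) * Complex.exp (t.im * p.2 * Complex.I) := fun p => by
    rw [← Complex.exp_add, Complex.inner]
    congr 1
    simp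
    ring
  simp_rw [h3]
  rw [integral_prod_mul (fun x : ℝ => Complex.exp (t.re * x * Complex.I))
    (fun y : ℝ => Complex.exp (t.im * y * Complex.I)), h1, h2, ← Complex.exp_add]
  congr 1
  rw [← Complex.normSq_eq_norm_sq, Complex.normSq_apply]
  push_cast
  ring

/-- A linear combination of independent standard complex Gaussians is a scaled standard complex
Gaussian. -/
theorem map_sum_mul_complexGaussian {n : ℕ} (x : Fin n → ℂ) :
    (Measure.pi fun _ : Fin n => complexGaussian).map (fun h => ∑ i, h i * x i) =
      complexGaussian.map (fun w => ((√(∑ i, ‖x i‖ ^ 2) : ℝ) : ℂ) * w) := by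
  have hmul : ∀ c t : ℂ, charFun (complexGaussian.map (fun w => w * c)) t =
      Complex.exp (-((‖t‖ ^ 2 * ‖c‖ ^ 2 : ℝ) : ℂ) / 4) := fun c t => by
    rw [charFun_apply, integral_map (by fun_prop) (by fun_prop)]
    have h1 := charFun_complexGaussian (t * (starRingEnd ℂ) c)
    rw [charFun_apply] at h1
    rw [norm_mul, Complex.norm_conj, mul_pow] at h1
    rw [← h1]
    congr 1
    ext w
    congr 3
    simp [Complex.inner]
    ring
  have hprob : ∀ i, IsProbabilityMeasure (complexGaussian.map (fun w => w * x i)) := fun i =>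
    Measure.isProbabilityMeasure_map (by fun_prop)
  have hpi : (Measure.pi fun _ : Fin n => complexGaussian).map (fun h i => h i * x i) =
      Measure.pi fun i => complexGaussian.map (fun w => w * x i) :=
    Measure.pi_map_pi (μ := fun _ => complexGaussian) (f := fun i w => w * x i)
      (fun i => by fun_prop)
  have hsum : (Measure.pi fun _ : Fin n => complexGaussian).map (fun h => ∑ i, h i * x i) =
      (Measure.pi fun i => complexGaussian.map (fun w => w * x i)).map (fun h => ∑ i, h i) := by
    rw [← hpi, Measure.map_map (by fun_prop) (by fun_prop)]
    rfl
  have : IsProbabilityMeasure ((Measure.pi fun _ : Fin n => complexGaussian).map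
      (fun h => ∑ i, h i * x i)) :=
    Measure.isProbabilityMeasure_map (Measurable.aemeasurable (by fun_prop))
  have : IsProbabilityMeasure (complexGaussian.map
      (fun w => ((√(∑ i, ‖x i‖ ^ 2) : ℝ) : ℂ) * w)) :=
    Measure.isProbabilityMeasure_map (by fun_prop)
  refine Measure.ext_of_charFun ?_
  ext t
  simp_rw [mul_comm (Complex.ofReal _)]
  rw [hmul, hsum, charFun_map_sum_pi_eq_prod, Finset.prod_apply]
  simp_rw [hmul]
  rw [← Complex.exp_sum]
  congr 1
  rw [Complex.norm_real, Real.norm_of_nonneg (Real.sqrt_nonneg _), Real.sq_sqrt (by positivity),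
    Finset.mul_sum]
  push_cast
  rw [← Finset.sum_neg_distrib, Finset.sum_div]

theorem lintegral_exp_neg_mul_sq_gaussianReal {c : ℝ} (hc : 0 ≤ c) :
    ∫⁻ x, ENNReal.ofReal (Real.exp (-c * x ^ 2)) ∂(gaussianReal 0 (1 / 2)) =
      ENNReal.ofReal (√(1 + c))⁻¹ := by
  have hv : (1 / 2 : NNReal) ≠ 0 := by norm_num
  rw [← ofReal_integral_eq_lintegral_ofReal, integral_gaussianReal_eq_integral_smul hv]
  · congr 1
    have h1 : ∀ x : ℝ, gaussianPDFReal 0 (1 / 2) x • Real.exp (-c * x ^ 2) =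
        (√Real.pi)⁻¹ * Real.exp (-(1 + c) * x ^ 2) := fun x => by
      rw [gaussianPDFReal, smul_eq_mul, mul_assoc, ← Real.exp_add]
      congr 3
      · push_cast; ring
      · push_cast; ring
    simp_rw [h1]
    rw [integral_const_mul, integral_gaussian, Real.sqrt_div Real.pi_pos.le]
    have := Real.sqrt_pos.2 Real.pi_pos
    field_simp
  · refine Integrable.of_bound (C := 1) (by fun_prop) (ae_of_all _ fun x => ?_)
    rw [Real.norm_of_nonneg (Real.exp_pos _).le]
    exact Real.exp_le_one_iff.2 (by nlinarith [mul_nonneg hc (sq_nonneg x)])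
  · exact ae_of_all _ fun x => (Real.exp_pos _).le

theorem lintegral_exp_neg_mul_norm_sq_complexGaussian {c : ℝ} (hc : 0 ≤ c) :
    ∫⁻ w, ENNReal.ofReal (Real.exp (-c * ‖w‖ ^ 2)) ∂complexGaussian =
      ENNReal.ofReal (1 / (1 + c)) := by
  rw [complexGaussian, lintegral_map (by fun_prop) measurable_complex_mk]
  have h1 : ∀ p : ℝ × ℝ, ENNReal.ofReal (Real.exp (-c * ‖(⟨p.1, p.2⟩ : ℂ)‖ ^ 2)) =
      ENNReal.ofReal (Real.exp (-c * p.1 ^ 2)) * ENNReal.ofReal (Real.exp (-c * p.2 ^ 2)) :=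
    fun p => by
      rw [← ENNReal.ofReal_mul (Real.exp_pos _).le, ← Real.exp_add, ← Complex.normSq_eq_norm_sq,
        Complex.normSq_apply]
      ring_nf
  simp_rw [h1]
  rw [lintegral_prod_mul (f := fun x : ℝ => ENNReal.ofReal (Real.exp (-c * x ^ 2)))
    (g := fun x : ℝ => ENNReal.ofReal (Real.exp (-c * x ^ 2))) (by fun_prop) (by fun_prop),
    lintegral_exp_neg_mul_sq_gaussianReal hc,
    ← ENNReal.ofReal_mul (by positivity), ← mul_inv, Real.mul_self_sqrt (by positivity), one_div]

theorem lintegral_exp_neg_mul_norm_sq_sum {n : ℕ} {c : ℝ} (hc : 0 ≤ c) (x : Fin n → ℂ) :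
    ∫⁻ h, ENNReal.ofReal (Real.exp (-c * ‖∑ i, h i * x i‖ ^ 2))
        ∂(Measure.pi fun _ : Fin n => complexGaussian) =
      ENNReal.ofReal (1 / (1 + c * ∑ i, ‖x i‖ ^ 2)) := by
  have h0 : (0 : ℝ) ≤ ∑ i, ‖x i‖ ^ 2 := by positivity
  rw [← lintegral_map (f := fun z : ℂ => ENNReal.ofReal (Real.exp (-c * ‖z‖ ^ 2)))
    (g := fun h : Fin n → ℂ => ∑ i, h i * x i) (by fun_prop) (by fun_prop),
    map_sum_mul_complexGaussian, lintegral_map (by fun_prop) (by fun_prop),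
    ← lintegral_exp_neg_mul_norm_sq_complexGaussian (mul_nonneg hc h0)]
  refine lintegral_congr fun w => ?_
  rw [norm_mul, mul_pow, Complex.norm_real, Real.norm_of_nonneg (Real.sqrt_nonneg _),
    Real.sq_sqrt h0]
  ring_nf

theorem lintegral_pi_prod {n : ℕ} {α : Type*} [MeasurableSpace α] (μ : Measure α)
    [IsProbabilityMeasure μ] (f : α → ℝ≥0∞) (hf : Measurable f) :
    ∫⁻ x, ∏ i, f (x i) ∂(Measure.pi fun _ : Fin n => μ) = (∫⁻ a, f a ∂μ) ^ n := by
  rw [lintegral_prod_eq_prod_lintegral_of_indepFun Finset.univ (fun i (x : Fin n → α) => f (x i))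
    (iIndepFun_pi fun i => hf.aemeasurable) (fun i => by fun_prop)]
  have h : ∀ i : Fin n, ∫⁻ x, f (x i) ∂(Measure.pi fun _ : Fin n => μ) = ∫⁻ a, f a ∂μ := fun i =>
    (measurePreserving_eval (fun _ : Fin n => μ) i).lintegral_comp hf
  simp [h]

/-- The complex vector with given real and imaginary parts. -/
def complexVec {n : ℕ} (d : RealIdx n → ℝ) : Fin n → ℂ := fun i => ⟨d (Sum.inl i), d (Sum.inr i)⟩

theorem realVec_complexVec {n : ℕ} (d : RealIdx n → ℝ) : realVec (complexVec d) = d := by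
  ext k
  cases k <;> rfl

theorem realChannel_mulVec {nt nr : ℕ} (H : Matrix (Fin nr) (Fin nt) ℂ) (d : RealIdx nt → ℝ) :
    realChannel H *ᵥ d = realVec (H *ᵥ complexVec d) := by
  ext j
  cases j <;>
  simp [realChannel, realVec, Matrix.mulVec, dotProduct, complexVec, Finset.sum_add_distrib,
    sub_eq_add_neg, add_comm]

theorem sum_realVec_sq {n : ℕ} (x : Fin n → ℂ) : ∑ j, realVec x j ^ 2 = ∑ i, ‖x i‖ ^ 2 := by
  rw [Fintype.sum_sum_type, ← Finset.sum_add_distrib]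
  refine Finset.sum_congr rfl fun i _ => ?_
  rw [← Complex.normSq_eq_norm_sq, Complex.normSq_apply]
  simp [realVec, sq]

/-- The moment generating function of the received power of a fixed vector. -/
theorem lintegral_exp_neg_channelLaw {nt nr : ℕ} {c : ℝ} (hc : 0 ≤ c) (d : RealIdx nt → ℝ) :
    ∫⁻ H, ENNReal.ofReal (Real.exp (-c * ∑ j, (realChannel H *ᵥ d) j ^ 2)) ∂(channelLaw nt nr) =
      ENNReal.ofReal ((1 / (1 + c * ∑ k, d k ^ 2)) ^ nr) := by
  have h1 : ∀ H : Matrix (Fin nr) (Fin nt) ℂ,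
      ENNReal.ofReal (Real.exp (-c * ∑ j, (realChannel H *ᵥ d) j ^ 2)) =
        ∏ j, ENNReal.ofReal (Real.exp (-c * ‖∑ i, H j i * complexVec d i‖ ^ 2)) := fun H => by
    rw [← ENNReal.ofReal_prod_of_nonneg fun j _ => (Real.exp_pos _).le, ← Real.exp_sum,
      realChannel_mulVec, sum_realVec_sq, Finset.mul_sum]
    rfl
  simp_rw [h1]
  have h0 : (0 : ℝ) ≤ ∑ k, d k ^ 2 := by positivity
  have h2 := lintegral_pi_prod (n := nr) (Measure.pi fun _ : Fin nt => complexGaussian)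
    (fun h => ENNReal.ofReal (Real.exp (-c * ‖∑ i, h i * complexVec d i‖ ^ 2))) (by fun_prop)
  rw [lintegral_exp_neg_mul_norm_sq_sum hc, ← sum_realVec_sq, realVec_complexVec,
    ← ENNReal.ofReal_pow (by positivity)] at h2
  exact h2

theorem map_re_complexGaussian : complexGaussian.map Complex.re = gaussianReal 0 (1 / 2) := by
  rw [complexGaussian, Measure.map_map Complex.measurable_re measurable_complex_mk]
  exact measurePreserving_fst.map_eq

/-- A linear functional of the noise is Gaussian. -/
theorem map_sum_realVec_noiseLaw {nr : ℕ} (b : RealIdx nr → ℝ) :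
    (noiseLaw nr).map (fun Z => ∑ j, b j * realVec Z j) =
      gaussianReal 0 (Real.toNNReal ((∑ j, b j ^ 2) / 2)) := by
  -- Conjugate weights, so that the real pairing with `b` is the real part of a complex linear form.
  let x : Fin nr → ℂ := fun i => ⟨b (Sum.inl i), -b (Sum.inr i)⟩
  have h1 : (fun Z : Fin nr → ℂ => ∑ j, b j * realVec Z j) =
      Complex.re ∘ fun Z => ∑ i, Z i * x i := by
    ext Z
    simp only [Function.comp, Complex.re_sum, Complex.mul_re, x, Fintype.sum_sum_type,
      ← Finset.sum_add_distrib]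
    refine Finset.sum_congr rfl fun i _ => ?_
    simp [realVec]
    ring
  have h2 : ∑ i, ‖x i‖ ^ 2 = ∑ j, b j ^ 2 := by
    rw [← sum_realVec_sq, Fintype.sum_sum_type, Fintype.sum_sum_type]
    simp [realVec, x]
  have h0 : (0 : ℝ) ≤ ∑ j, b j ^ 2 := by positivity
  rw [h1, ← Measure.map_map Complex.measurable_re (by fun_prop), noiseLaw,
    map_sum_mul_complexGaussian, h2, Measure.map_map Complex.measurable_re (by fun_prop)]
  have h3 : (Complex.re ∘ fun w => ((√(∑ j, b j ^ 2) : ℝ) : ℂ) * w) =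
      (fun t => √(∑ j, b j ^ 2) * t) ∘ Complex.re := by
    ext w
    simp
  rw [h3, ← Measure.map_map (by fun_prop) Complex.measurable_re, map_re_complexGaussian,
    gaussianReal_map_const_mul]
  congr 1
  · simp
  · ext
    rw [Real.coe_toNNReal _ (by positivity)]
    change √(∑ j, b j ^ 2) ^ 2 * ((1 / 2 : NNReal) : ℝ) = _
    rw [Real.sq_sqrt h0]
    push_cast
    ring

theorem gaussianReal_abs_ge_le (v : NNReal) {ε : ℝ} (hε : 0 ≤ ε) :
    gaussianReal 0 v {x | ε ≤ |x|} ≤ ENNReal.ofReal (2 * Real.exp (-ε ^ 2 / (2 * v))) := by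
  have hs : HasSubgaussianMGF id v (gaussianReal 0 v) :=
    ⟨integrable_exp_mul_gaussianReal, fun t => by rw [mgf_id_gaussianReal]; simp⟩
  have h1 := hs.measure_ge_le hε
  have h2 := hs.neg.measure_ge_le hε
  have hsub : {x : ℝ | ε ≤ |x|} ⊆ {x | ε ≤ id x} ∪ {x | ε ≤ (-id) x} := fun x hx => by
    simpa [le_abs] using hx
  refine (measure_mono hsub).trans ((measure_union_le _ _).trans ?_)
  rw [← ofReal_measureReal, ← ofReal_measureReal, ← ENNReal.ofReal_add (by positivity)
    (by positivity)]
  exact ENNReal.ofReal_le_ofReal (by linarith)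

theorem noiseLaw_abs_ge_le {nr : ℕ} (b : RealIdx nr → ℝ) {ε : ℝ} (hε : 0 ≤ ε) :
    noiseLaw nr {Z | ε ≤ |∑ j, b j * realVec Z j|} ≤
      ENNReal.ofReal (2 * Real.exp (-ε ^ 2 / ∑ j, b j ^ 2)) := by
  have h0 : (0 : ℝ) ≤ ∑ j, b j ^ 2 := by positivity
  have hmeas : Measurable fun Z : Fin nr → ℂ => ∑ j, b j * realVec Z j := by
    refine Finset.measurable_sum _ fun j _ => ?_
    cases j <;> simp only [realVec, Sum.elim_inl, Sum.elim_inr] <;> fun_prop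
  have h := gaussianReal_abs_ge_le (Real.toNNReal ((∑ j, b j ^ 2) / 2)) hε
  rw [← map_sum_realVec_noiseLaw, Measure.map_apply hmeas
    (measurableSet_le measurable_const (by fun_prop)), Real.coe_toNNReal _ (by positivity),
    mul_div_cancel₀ _ two_ne_zero] at h
  exact h

end VBLAST

/-! ### Transference for embedded integer lattices -/

open Module in
/-- Transference in coordinates: for an injective embedding `T` of `ℤ^ι` as a lattice, there is a
unimodular integer matrix whose rows are represented by short vectors. -/
theorem exists_unimodular_dual (ι : Type) [Fintype ι] [DecidableEq ι] [Nonempty ι] :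
    ∃ K : ℝ, 0 < K ∧ ∀ (F : Type) [NormedAddCommGroup F] [InnerProductSpace ℝ F]
      (T : (ι → ℝ) →ₗ[ℝ] F), Function.Injective T →
      ∃ (d : ι → ℤ) (A D : Matrix ι ι ℤ) (u : ι → F), d ≠ 0 ∧ A * D = 1 ∧
        (∀ m x, ∑ k, (A m k : ℝ) * x k = inner ℝ (u m) (T x)) ∧
        ∀ m, ‖T fun k => (d k : ℝ)‖ * ‖u m‖ ≤ K := by
  obtain ⟨K, hK, hbasis⟩ := ZLattice.exists_basis_coord_le (Fintype.card ι)
  refine ⟨K, hK, fun F _ _ T hT => ?_⟩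
  let E := LinearMap.range T
  let e : (ι → ℝ) ≃ₗ[ℝ] E := LinearEquiv.ofInjective T hT
  have heT : ∀ x, (e x : F) = T x := fun x => rfl
  have : FiniteDimensional ℝ E := e.finiteDimensional
  let bas : Basis ι ℝ E := (Pi.basisFun ℝ ι).map e
  have hbas : ∀ c : ι → ℝ, e c = ∑ k, c k • bas k := fun c => by
    conv_lhs => rw [← (Pi.basisFun ℝ ι).sum_repr c]
    rw [map_sum]
    simp [bas]
  have hbasZ : ∀ c : ι → ℤ, e (fun k => (c k : ℝ)) = ∑ k, c k • bas k := fun c => by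
    rw [hbas]
    simp_rw [Int.cast_smul_eq_zsmul]
  let L : Submodule ℤ E := Submodule.span ℤ (Set.range bas)
  have hLne : L ≠ ⊥ := fun h => by
    obtain ⟨k⟩ := ‹Nonempty ι›
    have h1 : bas k ∈ L := Submodule.subset_span ⟨k, rfl⟩
    rw [h, Submodule.mem_bot] at h1
    exact bas.ne_zero k h1
  obtain ⟨v, hvL, hv0, hv⟩ := ZLattice.exists_shortest L hLne
  obtain ⟨d, hd⟩ := (Submodule.mem_span_range_iff_exists_fun ℤ).1 hvL
  have hTd : e (fun k => (d k : ℝ)) = v := by rw [hbasZ, hd]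
  obtain ⟨b₀, hb₀span, hb₀⟩ := hbasis E (by rw [finrank_eq_card_basis bas]) L ‖v‖ hv
  let b : Basis ι ℝ E := b₀.reindex (Fintype.equivFin ι).symm
  have hbspan : Submodule.span ℤ (Set.range b) = L := by
    rw [Basis.range_reindex, hb₀span]
  have hb : ∀ m x, ‖v‖ * |b.repr x m| ≤ K * ‖x‖ := fun m x => by
    rw [Basis.repr_reindex_apply]
    exact hb₀ _ x
  have hA : ∀ m k, ∃ z : ℤ, (z : ℝ) = b.repr (bas k) m := fun m k => by
    have h1 : bas k ∈ Submodule.span ℤ (Set.range b) :=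
      hbspan ▸ Submodule.subset_span ⟨k, rfl⟩
    obtain ⟨z, hz⟩ := (b.mem_span_iff_repr_mem ℤ (bas k)).1 h1 m
    exact ⟨z, by simpa using hz⟩
  choose A hA using hA
  have hD : ∀ m, ∃ c : ι → ℤ, ∑ k, c k • bas k = b m := fun m => by
    have h1 : b m ∈ L := hbspan ▸ Submodule.subset_span ⟨m, rfl⟩
    exact (Submodule.mem_span_range_iff_exists_fun ℤ).1 h1
  choose D hD using hD
  -- The dual basis, as Riesz representatives of the coordinate functionals.
  let u : ι → E := fun m =>
    (InnerProductSpace.toDual ℝ E).symm (LinearMap.toContinuousLinearMap (b.coord m))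
  have hu : ∀ m x, inner ℝ (u m) x = b.repr x m := fun m x => by
    simp [u, InnerProductSpace.toDual_symm_apply]
  refine ⟨d, Matrix.of A, (Matrix.of D)ᵀ, fun m => u m, ?_, ?_, ?_, ?_⟩
  · rintro rfl
    exact hv0 (by rw [← hd]; simp)
  · ext m m'
    have h1 := congrArg (fun x => b.repr x m) (hD m')
    simp only [map_sum, Finsupp.coe_finsetSum, Finset.sum_apply, map_zsmul, Finsupp.smul_apply,
      zsmul_eq_mul, ← hA, Basis.repr_self, Finsupp.single_apply] at h1
    rw [Matrix.mul_apply, Matrix.one_apply]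
    simp only [Matrix.of_apply, Matrix.transpose_apply]
    rw [← Int.cast_inj (α := ℝ)]
    push_cast
    simp_rw [mul_comm ((A m _ : ℤ) : ℝ), eq_comm (a := m)]
    exact h1
  · intro m x
    rw [← heT, ← Submodule.coe_inner, hu, hbas]
    simp [hA, mul_comm]
  · intro m
    rw [← heT, hTd]
    change ‖v‖ * ‖u m‖ ≤ K
    -- Testing the coordinate bound at `u m` itself gives `‖v‖ ‖u m‖² ≤ K ‖u m‖`.
    have h1 := hb m (u m)
    rw [← hu, real_inner_self_eq_norm_sq, abs_of_nonneg (by positivity)] at h1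
    rcases (norm_nonneg (u m)).eq_or_lt with h | h
    · rw [← h]
      linarith
    · nlinarith

/-! ### Effective noise of an optimal pair -/

namespace VBLAST

theorem avgEnergy_eq {q : ℕ} (hq : 0 < q) : avgEnergy q = ((q : ℝ) ^ 2 - 1) / 12 := by
  have h : ∀ (c : ℝ) (n : ℕ), ∑ i ∈ Finset.range n, ((i : ℝ) - c) ^ 2 =
      n * (n - 1) * (2 * n - 1) / 6 - c * n * (n - 1) + n * c ^ 2 := fun c n => by
    induction n with
    | zero => simp
    | succ n ih => rw [Finset.sum_range_succ, ih]; push_cast; ring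
  rw [avgEnergy, Fin.sum_univ_eq_sum_range (fun i => ((i : ℝ) - centre q) ^ 2), h, centre]
  have : (0 : ℝ) < q := by exact_mod_cast hq
  field_simp
  ring

theorem avgEnergy_pos {q : ℕ} (hq : 1 < q) : 0 < avgEnergy q := by
  rw [avgEnergy_eq (by omega)]
  have : (1 : ℝ) < q := by exact_mod_cast hq
  nlinarith

/-- Peak energy is at most three times average energy for every `q`; this keeps the later constants
free of the constellation size. -/
theorem centred_sq_le {nt q : ℕ} (s : Symbols nt q) (k : RealIdx nt) :
    centred s k ^ 2 ≤ 3 * avgEnergy q := by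
  have h1 : (s k : ℕ) + 1 ≤ q := (s k).2
  have h2 : (((s k : Fin q) : ℕ) : ℝ) + 1 ≤ q := by exact_mod_cast h1
  have h3 : (0 : ℝ) ≤ ((s k : Fin q) : ℕ) := Nat.cast_nonneg _
  rw [avgEnergy_eq (by omega), centred, centre]
  nlinarith

/-- The optimal effective noise is at most inversely proportional to the received power of some
nonzero integer vector. -/
theorem exists_effectiveNoise_mul_le {nt : ℕ} (hnt : 0 < nt) : ∃ K : ℝ, 0 < K ∧
    ∀ (nr q : ℕ) (P : ℝ) (H : Matrix (Fin nr) (Fin nt) ℂ) (A : Matrix (RealIdx nt) (RealIdx nt) ℤ)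
      (B : Matrix (RealIdx nt) (RealIdx nr) ℝ), 1 < q → 0 < P → IsOptimalPair q P H A B →
      ∃ d : RealIdx nt → ℤ, d ≠ 0 ∧ ∀ m, effectiveNoise q P H (A m) (B m) *
        ((∑ k, (d k : ℝ) ^ 2) / avgEnergy q +
          2 * P / nt * ∑ j, (realChannel H *ᵥ fun k => (d k : ℝ)) j ^ 2) ≤ K := by
  have : Nonempty (RealIdx nt) := ⟨Sum.inl ⟨0, hnt⟩⟩
  obtain ⟨K, hK, hdual⟩ := exists_unimodular_dual (RealIdx nt)
  refine ⟨K ^ 2, by positivity, fun nr q P H A B hq hP hopt => ?_⟩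
  have hE := avgEnergy_pos hq
  have hnt' : (0 : ℝ) < nt := by exact_mod_cast hnt
  set α := √(avgEnergy q) with hα
  set β := √(2 * P / nt) with hβ
  have hα0 : 0 < α := Real.sqrt_pos.2 hE
  have hβ0 : 0 < β := Real.sqrt_pos.2 (by positivity)
  have hα2 : α ^ 2 = avgEnergy q := Real.sq_sqrt hE.le
  have hβ2 : β ^ 2 = 2 * P / nt := Real.sq_sqrt (by positivity)
  -- The weights are inverse to those of the effective noise. The first block makes `T` injective
  -- even when the channel is singular.
  let T : (RealIdx nt → ℝ) →ₗ[ℝ] EuclideanSpace ℝ (RealIdx nt ⊕ RealIdx nr) :=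
    { toFun := fun x => WithLp.toLp 2 (Sum.elim (α⁻¹ • x) (β • (realChannel H *ᵥ x)))
      map_add' := fun x y => by
        ext i; cases i <;> simp [Matrix.mulVec_add]
      map_smul' := fun c x => by
        ext i; cases i <;> simp [Matrix.mulVec_smul, mul_left_comm] }
  have hT : Function.Injective T := fun x y hxy => by
    ext k
    have h1 : α⁻¹ * x k = α⁻¹ * y k := congrArg (fun z : EuclideanSpace ℝ _ => z (Sum.inl k)) hxy
    exact mul_left_cancel₀ (inv_ne_zero hα0.ne') h1
  obtain ⟨d, A', D, u, hd, hAD, hu, hle⟩ := hdual _ T hT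
  refine ⟨d, hd, fun m => ?_⟩
  have hunit : IsUnit (modMatrix q A') := by
    refine IsUnit.of_mul_eq_one (modMatrix q D) ?_
    have h1 := congrArg (fun X : Matrix (RealIdx nt) (RealIdx nt) ℤ =>
      X.map (Int.castRingHom (ZMod q))) hAD
    simp only [Matrix.map_mul] at h1
    rw [Matrix.map_one _ (map_zero _) (map_one _)] at h1
    exact h1
  obtain ⟨m', hm'⟩ := hopt.2 A' (fun m j => β * u m (Sum.inr j)) hunit m
  have hnorm : ‖T fun k => (d k : ℝ)‖ ^ 2 = (∑ k, (d k : ℝ) ^ 2) / avgEnergy q +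
      2 * P / nt * ∑ j, (realChannel H *ᵥ fun k => (d k : ℝ)) j ^ 2 := by
    rw [EuclideanSpace.real_norm_sq_eq, Fintype.sum_sum_type, ← hα2, ← hβ2, Finset.mul_sum,
      Finset.sum_div]
    congr 1
    · refine Finset.sum_congr rfl fun k _ => ?_
      change (α⁻¹ * (d k : ℝ)) ^ 2 = _
      field_simp
    · refine Finset.sum_congr rfl fun j _ => ?_
      change (β * (realChannel H *ᵥ fun k => (d k : ℝ)) j) ^ 2 = _
      ring
  -- Evaluating the duality identity on the unit vector at `k` shows that the mismatch of the chosen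
  -- filter is the first block of `u m'`, up to scale.
  have hrow : ∀ k, ((fun j => β * u m' (Sum.inr j)) ᵥ* realChannel H) k - (A' m' k : ℝ) =
      -(α⁻¹ * u m' (Sum.inl k)) := fun k => by
    have h1 := hu m' (Pi.single k 1)
    have h2 : inner ℝ (u m') (T (Pi.single k 1)) = α⁻¹ * u m' (Sum.inl k) +
        ∑ j, u m' (Sum.inr j) * (β * realChannel H j k) := by
      rw [PiLp.inner_apply, Fintype.sum_sum_type (α₁ := RealIdx nt) (α₂ := RealIdx nr)]
      congr 1
      · rw [Finset.sum_eq_single k]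
        · simp [T]
        · intro j _ hj
          simp [T, hj]
        · simp
      · refine Finset.sum_congr rfl fun j _ => ?_
        simp [T, mul_comm]
    rw [h2] at h1
    have h3 : ∑ k', (A' m' k' : ℝ) * (Pi.single k 1 : RealIdx nt → ℝ) k' = A' m' k := by
      simp [Pi.single_apply]
    rw [h3] at h1
    rw [h1, Matrix.vecMul, dotProduct]
    have h4 : ∑ j, β * u m' (Sum.inr j) * realChannel H j k =
        ∑ j, u m' (Sum.inr j) * (β * realChannel H j k) :=
      Finset.sum_congr rfl fun j _ => by ring
    rw [h4]
    ring
  have hnoise : effectiveNoise q P H (A' m') (fun j => β * u m' (Sum.inr j)) = ‖u m'‖ ^ 2 := by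
    rw [effectiveNoise, EuclideanSpace.real_norm_sq_eq,
      Fintype.sum_sum_type (α₁ := RealIdx nt) (α₂ := RealIdx nr), Finset.sum_mul, Finset.mul_sum]
    congr 1
    · refine Finset.sum_congr rfl fun k _ => ?_
      rw [hrow, ← hα2]
      field_simp
    · refine Finset.sum_congr rfl fun j _ => ?_
      rw [mul_pow, hβ2]
      field_simp
  rw [← hnorm]
  calc _ ≤ ‖u m'‖ ^ 2 * ‖T fun k => (d k : ℝ)‖ ^ 2 :=
        mul_le_mul_of_nonneg_right (hm'.trans_eq hnoise) (by positivity)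
    _ = (‖T fun k => (d k : ℝ)‖ * ‖u m'‖) ^ 2 := by ring
    _ ≤ K ^ 2 := pow_le_pow_left₀ (by positivity) (hle m') 2

/-! ### Error probability for a fixed channel -/

instance isProbabilityMeasure_noiseLaw (nr : ℕ) : IsProbabilityMeasure (noiseLaw nr) :=
  inferInstanceAs (IsProbabilityMeasure (Measure.pi fun _ => complexGaussian))

theorem observation_eq {nt nr q : ℕ} (hnt : 0 < nt) {P : ℝ} (hP : 0 < P)
    (H : Matrix (Fin nr) (Fin nt) ℂ) (s : Symbols nt q) (Z : Fin nr → ℂ) :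
    observation P H s Z = realChannel H *ᵥ centred s + √(nt / P) • realVec Z := by
  have hnt' : (0 : ℝ) < nt := by exact_mod_cast hnt
  have h1 : √(nt : ℝ) / √P * (√P / √nt) = 1 := by
    have := Real.sqrt_pos.2 hP
    have := Real.sqrt_pos.2 hnt'
    field_simp
  have h2 : codeword s = complexVec (centred s) := rfl
  ext j
  rw [observation, realChannel_mulVec, ← h2]
  cases j <;>
  simp [realVec, received, mul_add, ← mul_assoc, h1]

/-- Splits the decision error into symbol leakage, deterministic once `s` and the channel are fixed,
and Gaussian noise. -/
theorem Receiver.filtered_sub_target {nt nr q : ℕ} (hnt : 0 < nt) {P : ℝ} (hP : 0 < P)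
    (rx : Receiver nt nr) (H : Matrix (Fin nr) (Fin nt) ℂ) (s : Symbols nt q) (Z : Fin nr → ℂ)
    (m : RealIdx nt) :
    rx.filtered P H s Z m - (rx.target P H s m : ℝ) =
      ∑ k, ((rx.B P H m ᵥ* realChannel H) k - (rx.A P H m k : ℝ)) * centred s k +
        √(nt / P) * ∑ j, rx.B P H m j * realVec Z j := by
  have h1 : (rx.B P H *ᵥ observation P H s Z) m = rx.B P H m ⬝ᵥ observation P H s Z := rfl
  have h2 : (rx.target P H s m : ℝ) = ∑ k, (rx.A P H m k : ℝ) * ((s k : ℕ) : ℝ) := by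
    simp only [Receiver.target, Matrix.mulVec, dotProduct]
    push_cast
    rfl
  rw [Receiver.filtered, h1, observation_eq hnt hP, dotProduct_add, Matrix.dotProduct_mulVec,
    dotProduct_smul, h2]
  simp only [dotProduct, sub_mul, Finset.sum_sub_distrib, centred, mul_sub, smul_eq_mul]
  ring

theorem Receiver.half_le_of_latticeOutput_ne {nt nr q : ℕ} {P : ℝ} (rx : Receiver nt nr)
    (H : Matrix (Fin nr) (Fin nt) ℂ) (s : Symbols nt q) (Z : Fin nr → ℂ) (m : RealIdx nt)
    (h : rx.latticeOutput P H s Z m ≠ rx.target P H s m) :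
    1 / 2 ≤ |rx.filtered P H s Z m - (rx.target P H s m : ℝ)| := by
  by_contra! hlt
  refine h ?_
  have h1 := abs_sub_round (rx.filtered P H s Z m)
  have h2 : |((rx.latticeOutput P H s Z m - rx.target P H s m : ℤ) : ℝ)| < 1 := by
    push_cast
    rw [Receiver.latticeOutput, abs_lt]
    rw [abs_le] at h1
    rw [abs_lt] at hlt
    constructor <;> linarith
  rw [← Int.cast_abs] at h2
  have h3 : |rx.latticeOutput P H s Z m - rx.target P H s m| < 1 := by exact_mod_cast h2
  exact sub_eq_zero.1 (Int.abs_lt_one_iff.1 h3)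

/-- Error probability of a layer for a fixed channel, in terms of the effective noise power. -/
theorem Receiver.noiseLaw_error_le {nt nr q : ℕ} (hnt : 0 < nt) (hq : 1 < q) {P : ℝ} (hP : 0 < P)
    (rx : Receiver nt nr) (H : Matrix (Fin nr) (Fin nt) ℂ) (s : Symbols nt q) (m : RealIdx nt)
    {t : ℝ} (ht : 0 ≤ t)
    (hg : effectiveNoise q P H (rx.A P H m) (rx.B P H m) * (96 * nt * t) ≤ 1) :
    noiseLaw nr {Z | rx.latticeOutput P H s Z m ≠ rx.target P H s m} ≤
      ENNReal.ofReal (3 * Real.exp (-t)) := by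
  have hnt' : (1 : ℝ) ≤ nt := by exact_mod_cast hnt
  have hE := avgEnergy_pos hq
  set V := ∑ k, ((rx.B P H m ᵥ* realChannel H) k - (rx.A P H m k : ℝ)) ^ 2 with hV
  set S := ∑ j, rx.B P H m j ^ 2 with hS
  have hV0 : 0 ≤ V := by positivity
  have hS0 : 0 ≤ S := by positivity
  have hgeq : effectiveNoise q P H (rx.A P H m) (rx.B P H m) =
    V * avgEnergy q + nt / (2 * P) * S := rfl
  rw [hgeq] at hg
  set μ := ∑ k, ((rx.B P H m ᵥ* realChannel H) k - (rx.A P H m k : ℝ)) * centred s k with hμ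
  have hnP : 0 < (nt : ℝ) / P := by positivity
  -- The decision margin `1 / 2` is shared equally between leakage and noise.
  by_cases hsmall : |μ| ≤ 1 / 4
  · have hsub : {Z | rx.latticeOutput P H s Z m ≠ rx.target P H s m} ⊆
        {Z | 1 / 4 / √(nt / P) ≤ |∑ j, rx.B P H m j * realVec Z j|} := fun Z hZ => by
      have h1 := rx.half_le_of_latticeOutput_ne H s Z m hZ
      rw [rx.filtered_sub_target hnt hP] at h1
      have h2 := h1.trans (abs_add_le _ _)
      rw [abs_mul, abs_of_nonneg (Real.sqrt_nonneg _)] at h2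
      change 1 / 4 / √(nt / P) ≤ _
      rw [div_le_iff₀ (Real.sqrt_pos.2 hnP)]
      linarith
    -- With a zero filter row the tail bound divides by zero and says nothing, but then there is no
    -- noise.
    rcases hS0.eq_or_lt with hzero | hpos
    · have hB : ∀ j, rx.B P H m j = 0 := fun j => by
        have := (Finset.sum_eq_zero_iff_of_nonneg (fun j _ => sq_nonneg (rx.B P H m j))).1
          hzero.symm j (Finset.mem_univ j)
        exact pow_eq_zero_iff two_ne_zero |>.1 this
      have hempty :
          {Z : Fin nr → ℂ | 1 / 4 / √(nt / P) ≤ |∑ j, rx.B P H m j * realVec Z j|} = ∅ := by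
        refine Set.eq_empty_of_forall_notMem fun Z hZ => ?_
        simp only [hB, zero_mul, Finset.sum_const_zero, abs_zero, Set.mem_ofPred_eq] at hZ
        have : 0 < 1 / 4 / √(nt / P) := div_pos (by norm_num) (Real.sqrt_pos.2 hnP)
        linarith
      refine (measure_mono hsub).trans ?_
      rw [hempty, measure_empty]
      exact zero_le
    · refine (measure_mono hsub).trans ((noiseLaw_abs_ge_le _ (by positivity)).trans ?_)
      refine ENNReal.ofReal_le_ofReal ?_
      have h1 : -(1 / 4 / √(nt / P)) ^ 2 / S ≤ -t := by
        rw [div_pow, Real.sq_sqrt hnP.le, neg_div, neg_le_neg_iff, le_div_iff₀ hpos,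
          le_div_iff₀ hnP]
        have h2 : (nt : ℝ) / (2 * P) * S * (32 * t) ≤ 1 := by
          refine le_trans ?_ hg
          gcongr
          · have := mul_nonneg hV0 hE.le
            linarith
          · linarith
        have h3 : (nt : ℝ) / (2 * P) = nt / P / 2 := by field_simp
        rw [h3] at h2
        nlinarith
      have h4 := Real.exp_le_exp.2 h1
      have h5 := Real.exp_pos (-t)
      linarith
  -- Cauchy–Schwarz with `2 * nt` symbols of energy at most `3 * avgEnergy q`. Leakage above `1 / 4`
  -- then forces `t ≤ 1`, where `3 * exp (-t) ≥ 1` is trivial. Hence `96 = 16 * 6` and the prefactor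
  -- `3 ≥ e`.
  · have h1 : μ ^ 2 ≤ V * (6 * nt * avgEnergy q) := by
      refine (Finset.sum_mul_sq_le_sq_mul_sq _ _ _).trans
        (mul_le_mul_of_nonneg_left ?_ hV0)
      refine (Finset.sum_le_card_nsmul _ _ _ fun k _ => centred_sq_le s k).trans ?_
      simp
      linarith
    have h2 : 1 / 16 < μ ^ 2 := by
      rw [← sq_abs]
      nlinarith [abs_nonneg μ]
    have h3 : t ≤ 1 := by
      by_contra! h
      have h4 : 1 < (V * avgEnergy q + nt / (2 * P) * S) * (96 * nt) := by
        have : 0 ≤ nt / (2 * P) * S * (96 * nt) := by positivity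
        nlinarith
      nlinarith
    refine prob_le_one.trans ?_
    rw [← ENNReal.ofReal_one]
    refine ENNReal.ofReal_le_ofReal ?_
    have h4 : Real.exp (-1) ≤ Real.exp (-t) := Real.exp_le_exp.2 (by linarith)
    have h5 : 1 / 3 ≤ Real.exp (-1) := by
      rw [Real.exp_neg, one_div]
      exact inv_anti₀ (Real.exp_pos 1) (by linarith [Real.exp_one_lt_d9])
    linarith

/-- Error probability of a layer for a fixed channel, in terms of the received power of a nonzero
integer vector. -/
theorem exists_noiseLaw_error_le {nt : ℕ} (hnt : 0 < nt) : ∃ κ : ℝ, 0 < κ ∧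
    ∀ (nr q : ℕ) (P : ℝ) (H : Matrix (Fin nr) (Fin nt) ℂ) (rx : Receiver nt nr), 1 < q → 0 < P →
      IsOptimalPair q P H (rx.A P H) (rx.B P H) →
      ∃ d : RealIdx nt → ℤ, d ≠ 0 ∧ ∀ (s : Symbols nt q) m,
        noiseLaw nr {Z | rx.latticeOutput P H s Z m ≠ rx.target P H s m} ≤
          ENNReal.ofReal (3 * Real.exp (-(κ / avgEnergy q) * ∑ k, (d k : ℝ) ^ 2) *
            Real.exp (-(κ * P) * ∑ j, (realChannel H *ᵥ fun k => (d k : ℝ)) j ^ 2)) := by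
  obtain ⟨K, hK, h⟩ := exists_effectiveNoise_mul_le hnt
  have hnt' : (1 : ℝ) ≤ nt := by exact_mod_cast hnt
  have hnt0 : (0 : ℝ) < nt := by linarith
  refine ⟨1 / (96 * nt ^ 2 * K), by positivity, fun nr q P H rx hq hP hopt => ?_⟩
  obtain ⟨d, hd, hle⟩ := h nr q P H _ _ hq hP hopt
  have hE := avgEnergy_pos hq
  refine ⟨d, hd, fun s m => ?_⟩
  set X := ∑ k, (d k : ℝ) ^ 2
  set Y := ∑ j, (realChannel H *ᵥ fun k => (d k : ℝ)) j ^ 2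
  have hX : 0 ≤ X := by positivity
  have hY : 0 ≤ Y := by positivity
  set κ := 1 / (96 * (nt : ℝ) ^ 2 * K) with hκ
  have hκ0 : 0 < κ := by positivity
  have hg0 : 0 ≤ effectiveNoise q P H (rx.A P H m) (rx.B P H m) := by
    rw [effectiveNoise]; positivity
  have key : 96 * nt * (κ / avgEnergy q * X + κ * P * Y) ≤
      K⁻¹ * (X / avgEnergy q + 2 * P / nt * Y) := by
    have h1 : 96 * nt * (κ / avgEnergy q * X + κ * P * Y) =
        K⁻¹ * (X / avgEnergy q / nt + P / nt * Y) := by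
      rw [hκ]; field_simp
    rw [h1]
    refine mul_le_mul_of_nonneg_left (add_le_add ?_ ?_) (by positivity)
    · exact div_le_self (by positivity) hnt'
    · refine mul_le_mul_of_nonneg_right ?_ hY
      gcongr
      linarith
  have := rx.noiseLaw_error_le hnt hq hP H s m (t := κ / avgEnergy q * X + κ * P * Y)
    (by positivity) (by
      refine (mul_le_mul_of_nonneg_left key hg0).trans ?_
      rw [mul_left_comm, inv_mul_le_iff₀ hK, mul_one]
      exact hle m)
  refine this.trans_eq ?_
  rw [mul_assoc 3, ← Real.exp_add]
  congr 3
  ring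

end VBLAST

/-! ### Averaging over the channel -/

/-- The Epstein zeta series of `ℤ^ι` converges. -/
theorem summable_inv_sum_sq_pow (ι : Type) [Fintype ι] {N : ℕ} (hN : Fintype.card ι < 2 * N) :
    Summable fun d : ι → ℤ => (∑ k, (d k : ℝ) ^ 2)⁻¹ ^ N := by
  let b := (EuclideanSpace.basisFun ι ℝ).toBasis
  let L := Submodule.span ℤ (Set.range b)
  have hrank : Module.finrank ℤ L = Fintype.card ι := by
    rw [ZLattice.rank ℝ L]; simp
  have hs := ZLattice.summable_norm_pow_inv L (2 * N) (by rw [hrank]; exact hN)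
  let f : (ι → ℤ) → L := fun d => ⟨∑ k, d k • b k, Submodule.sum_mem _ fun k _ =>
    Submodule.smul_mem _ _ (Submodule.subset_span ⟨k, rfl⟩)⟩
  have hf : ∀ d k, (f d : EuclideanSpace ℝ ι) k = d k := fun d k => by
    classical
    simp [f, b, Pi.single_apply]
  have hinj : Function.Injective f := fun d d' h => by
    ext k
    have h1 := hf d k
    rw [h, hf] at h1
    exact Int.cast_injective h1.symm
  refine (hs.comp_injective hinj).congr fun d => ?_
  simp only [Function.comp]
  rw [pow_mul, inv_pow, Submodule.coe_norm, EuclideanSpace.real_norm_sq_eq]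
  simp only [hf]

namespace VBLAST

theorem one_le_sum_sq_of_ne_zero {ι : Type} [Fintype ι] {d : ι → ℤ} (hd : d ≠ 0) :
    (1 : ℝ) ≤ ∑ k, (d k : ℝ) ^ 2 := by
  obtain ⟨k, hk⟩ := Function.ne_iff.1 hd
  have h1 : 0 < (d k) ^ 2 := sq_pos_of_ne_zero hk
  have h2 : (1 : ℝ) ≤ (d k : ℝ) ^ 2 := by exact_mod_cast h1
  exact h2.trans (Finset.single_le_sum (f := fun k => (d k : ℝ) ^ 2)
    (fun i _ => sq_nonneg _) (Finset.mem_univ k))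

theorem measurable_sum_realChannel_mulVec_sq {nt nr : ℕ} (d : RealIdx nt → ℝ) :
    Measurable fun H : Matrix (Fin nr) (Fin nt) ℂ => ∑ j, (realChannel H *ᵥ d) j ^ 2 := by
  have hentry : ∀ i j, Measurable fun H : Matrix (Fin nr) (Fin nt) ℂ => H i j := fun i j =>
    (measurable_pi_apply j).comp (measurable_pi_apply i)
  simp_rw [realChannel_mulVec, sum_realVec_sq, Matrix.mulVec, dotProduct]
  fun_prop

/-- Error probability of the worst layer of each channel, averaged over the channel. -/
noncomputable def Receiver.worstLayerError {nt nr : ℕ} (rx : Receiver nt nr) {q : ℕ}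
    (s : Symbols nt q) (P : ℝ) : ℝ≥0∞ :=
  ∫⁻ H, ⨆ m, noiseLaw nr {Z | rx.latticeOutput P H s Z m ≠ rx.target P H s m} ∂(channelLaw nt nr)

/-- The error probability of the worst layer is at most a sum over the nonzero integer vectors. -/
theorem exists_worstLayerError_le {nt : ℕ} (hnt : 0 < nt) : ∃ κ : ℝ, 0 < κ ∧
    (∀ (nr q : ℕ) (rx : Receiver nt nr), 1 < q → rx.IsIntegerForcing q →
      ∀ (s : Symbols nt q) (P : ℝ), 0 < P → rx.worstLayerError s P ≤
        ∑' d : {d : RealIdx nt → ℤ // d ≠ 0}, ENNReal.ofReal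
          (3 * Real.exp (-(κ / avgEnergy q) * ∑ k, (d.1 k : ℝ) ^ 2) *
            (1 / (1 + κ * P * ∑ k, (d.1 k : ℝ) ^ 2)) ^ nr)) ∧
    (∀ (q : ℕ) (rx : Receiver nt 1), nt = 1 → 1 < q → rx.IsIntegerForcing q →
      ∀ (s : Symbols nt q) (P : ℝ), 0 < P →
        rx.worstLayerError s P ≤ ENNReal.ofReal (3 * (1 / (1 + κ * P)) ^ 1)) := by
  obtain ⟨κ, hκ, h⟩ := exists_noiseLaw_error_le hnt
  refine ⟨κ, hκ, fun nr q rx hq hrx s P hP => ?_, fun q rx hnt1 hq hrx s P hP => ?_⟩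
  · have hE := avgEnergy_pos hq
    have hmeas : ∀ d : {d : RealIdx nt → ℤ // d ≠ 0}, Measurable fun H =>
        ENNReal.ofReal (Real.exp (-(κ * P) *
          ∑ j, (realChannel (nr := nr) H *ᵥ fun k => (d.1 k : ℝ)) j ^ 2)) := fun d => by
      have := measurable_sum_realChannel_mulVec_sq (nr := nr) fun k => (d.1 k : ℝ)
      fun_prop
    calc rx.worstLayerError s P
        ≤ ∫⁻ H, ∑' d : {d : RealIdx nt → ℤ // d ≠ 0},
            ENNReal.ofReal (3 * Real.exp (-(κ / avgEnergy q) * ∑ k, (d.1 k : ℝ) ^ 2)) *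
            ENNReal.ofReal (Real.exp (-(κ * P) *
              ∑ j, (realChannel H *ᵥ fun k => (d.1 k : ℝ)) j ^ 2)) ∂(channelLaw nt nr) := by
          refine lintegral_mono_ae ?_
          filter_upwards [hrx P hP] with H hH
          obtain ⟨d, hd, hle⟩ := h nr q P H rx hq hP hH
          refine (iSup_le (hle s)).trans ?_
          rw [ENNReal.ofReal_mul (by positivity)]
          -- The vector `d` serves all layers at once but varies with the channel; dominating its
          -- term by the whole series avoids a measurable choice of `d`.
          exact ENNReal.le_tsum (f := fun d : {d : RealIdx nt → ℤ // d ≠ 0} =>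
            ENNReal.ofReal (3 * Real.exp (-(κ / avgEnergy q) * ∑ k, (d.1 k : ℝ) ^ 2)) *
            ENNReal.ofReal (Real.exp (-(κ * P) *
              ∑ j, (realChannel H *ᵥ fun k => (d.1 k : ℝ)) j ^ 2))) ⟨d, hd⟩
      _ = _ := by
          rw [lintegral_tsum fun d => ((hmeas d).const_mul _).aemeasurable]
          refine tsum_congr fun d => ?_
          rw [lintegral_const_mul _ (hmeas d), lintegral_exp_neg_channelLaw (by positivity),
            ← ENNReal.ofReal_mul (by positivity)]
  · subst hnt1
    have hmeas : Measurable fun H => ENNReal.ofReal (Real.exp (-(κ * P) *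
        ∑ j, (realChannel (nr := 1) H *ᵥ (Pi.single (Sum.inl 0) 1 : RealIdx 1 → ℝ)) j ^ 2)) := by
      have := measurable_sum_realChannel_mulVec_sq (nr := 1)
        (Pi.single (Sum.inl 0) 1 : RealIdx 1 → ℝ)
      fun_prop
    have hX : ∑ k, (Pi.single (Sum.inl 0) 1 : RealIdx 1 → ℝ) k ^ 2 = 1 := by
      simp
    calc rx.worstLayerError s P
        ≤ ∫⁻ H, ENNReal.ofReal 3 * ENNReal.ofReal (Real.exp (-(κ * P) *
            ∑ j, (realChannel H *ᵥ (Pi.single (Sum.inl 0) 1 : RealIdx 1 → ℝ)) j ^ 2))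
            ∂(channelLaw 1 1) := by
          refine lintegral_mono_ae ?_
          filter_upwards [hrx P hP] with H hH
          obtain ⟨d, hd, hle⟩ := h 1 q P H rx hq hP hH
          refine (iSup_le (hle s)).trans ?_
          rw [← ENNReal.ofReal_mul (by norm_num)]
          refine ENNReal.ofReal_le_ofReal ?_
          have hE := avgEnergy_pos hq
          have hd1 := one_le_sum_sq_of_ne_zero hd
          -- A single complex gain acts as a scaled rotation, so `d` may be replaced by a unit
          -- vector.
          have hpow : ∀ x : RealIdx 1 → ℝ, ∑ j, (realChannel H *ᵥ x) j ^ 2 =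
              ‖H 0 0‖ ^ 2 * ∑ k, x k ^ 2 := fun x => by
            rw [realChannel_mulVec, sum_realVec_sq, ← realVec_complexVec x, sum_realVec_sq,
              realVec_complexVec]
            simp [Matrix.mulVec, dotProduct, mul_pow]
          rw [hpow, hpow, hX, mul_one]
          have h1 : Real.exp (-(κ / avgEnergy q) * ∑ k, (d k : ℝ) ^ 2) ≤ 1 := by
            rw [Real.exp_le_one_iff, neg_mul, neg_nonpos]
            positivity
          have h2 : Real.exp (-(κ * P) * (‖H 0 0‖ ^ 2 * ∑ k, (d k : ℝ) ^ 2)) ≤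
              Real.exp (-(κ * P) * ‖H 0 0‖ ^ 2) := by
            rw [Real.exp_le_exp, neg_mul, neg_mul, neg_le_neg_iff]
            refine mul_le_mul_of_nonneg_left ?_ (by positivity)
            exact le_mul_of_one_le_right (by positivity) hd1
          calc _ ≤ 3 * 1 * Real.exp (-(κ * P) * ‖H 0 0‖ ^ 2) := by gcongr
            _ = _ := by ring
      _ = _ := by
          rw [lintegral_const_mul _ hmeas, lintegral_exp_neg_channelLaw (by positivity), hX,
            ← ENNReal.ofReal_mul (by norm_num), mul_one]

/-- A termwise bound by a convergent series. -/
theorem tsum_le_of_le_inv_pow {nt nr : ℕ} {x M : ℝ} (hx : 0 ≤ x) (hM : 0 ≤ M)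
    (f : {d : RealIdx nt → ℤ // d ≠ 0} → ℝ)
    (hf : ∀ d, f d ≤ M * (∑ k, (d.1 k : ℝ) ^ 2)⁻¹ ^ (nt + 1) * (1 / (1 + x)) ^ nr) :
    ∑' d, ENNReal.ofReal (f d) ≤ ENNReal.ofReal
      (M * (∑' d : RealIdx nt → ℤ, (∑ k, (d k : ℝ) ^ 2)⁻¹ ^ (nt + 1)) * (1 / (1 + x)) ^ nr) := by
  have hs := summable_inv_sum_sq_pow (RealIdx nt) (N := nt + 1) (by simp; omega)
  have hs' := (hs.mul_left M).mul_right ((1 / (1 + x)) ^ nr)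
  calc ∑' d, ENNReal.ofReal (f d)
      ≤ ∑' d : {d : RealIdx nt → ℤ // d ≠ 0}, ENNReal.ofReal
          (M * (∑ k, (d.1 k : ℝ) ^ 2)⁻¹ ^ (nt + 1) * (1 / (1 + x)) ^ nr) :=
        ENNReal.tsum_le_tsum fun d => ENNReal.ofReal_le_ofReal (hf d)
    _ ≤ ∑' d : RealIdx nt → ℤ, ENNReal.ofReal
          (M * (∑ k, (d k : ℝ) ^ 2)⁻¹ ^ (nt + 1) * (1 / (1 + x)) ^ nr) :=
        -- The added term at zero vanishes, since `0⁻¹ = 0`.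
        ENNReal.tsum_comp_le_tsum_of_injective Subtype.val_injective _
    _ = _ := by
        rw [← ENNReal.ofReal_tsum_of_nonneg (fun d => by positivity) hs', tsum_mul_right,
          tsum_mul_left]

/-! ### Constants in the layer bounds -/

/-- The averaged error probability of the worst layer is at most `(1 / (1 + c P)) ^ nr` for all
powers `P ≥ P₀`. -/
def Receiver.WorstLayerBound {nt nr : ℕ} (rx : Receiver nt nr) (q : ℕ) (c P₀ : ℝ) : Prop :=
  ∀ P : ℝ, P₀ ≤ P → ∀ s : Symbols nt q,
    rx.worstLayerError s P ≤ ENNReal.ofReal ((1 / (1 + c * P)) ^ nr)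

/-- A multiplicative constant can be absorbed by the coefficient of the power. -/
theorem Receiver.worstLayerBound_of_le {nt nr q : ℕ} (rx : Receiver nt nr) (hnr : 0 < nr)
    {κ C P₁ : ℝ} (hκ : 0 < κ) (hC : 1 ≤ C)
    (h : ∀ P, P₁ ≤ P → ∀ s : Symbols nt q,
      rx.worstLayerError s P ≤ ENNReal.ofReal (C * (1 / (1 + κ * P)) ^ nr)) :
    rx.WorstLayerBound q (κ / (2 * C)) (max P₁ (2 * C / κ)) := fun P hP s => by
  have hP1 := (le_max_left _ _).trans hP
  have hP2 := (le_max_right _ _).trans hP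
  have hP0 : 0 < P := lt_of_lt_of_le (by positivity) hP2
  refine (h P hP1 s).trans (ENNReal.ofReal_le_ofReal ?_)
  -- Spending one factor `C` per receive antenna keeps the new coefficient independent of `nr`; the
  -- factor `2` pays for the `1` in `1 + κ * P` once `P ≥ 2 * C / κ`.
  calc C * (1 / (1 + κ * P)) ^ nr ≤ C ^ nr * (1 / (1 + κ * P)) ^ nr := by
        gcongr
        exact le_self_pow₀ hC hnr.ne'
    _ = (C / (1 + κ * P)) ^ nr := by rw [← mul_pow]; ring
    _ ≤ _ := by
        refine pow_le_pow_left₀ (by positivity) ?_ nr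
        rw [div_le_div_iff₀ (by positivity) (by positivity)]
        have h1 : C * (κ / (2 * C) * P) = κ * P / 2 := by field_simp
        have h2 : 2 * C ≤ κ * P := by
          rw [div_le_iff₀ hκ] at hP2
          linarith
        nlinarith

/-- The layer bound with constants depending on the constellation. -/
theorem exists_worstLayerBound {nt : ℕ} (hnt : 0 < nt) {q : ℕ} (hq : 1 < q) :
    ∃ c P₀ : ℝ, 0 < c ∧ 0 < P₀ ∧ ∀ nr : ℕ, nt ≤ nr → ∀ rx : Receiver nt nr,
      rx.IsIntegerForcing q → rx.WorstLayerBound q c P₀ := by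
  obtain ⟨κ, hκ, h, -⟩ := exists_worstLayerError_le hnt
  have hE := avgEnergy_pos hq
  set a := κ / avgEnergy q with ha
  have ha0 : 0 < a := by positivity
  -- From `exp (-y) ≤ (nt + 1)! / y ^ (nt + 1)` with `y = a * X`. The exponent `nt + 1` is the least
  -- integer power of `X⁻¹` summable on `ℤ^(2nt)`.
  set M := 3 * ((nt + 1).factorial / a ^ (nt + 1)) with hM
  set S := ∑' d : RealIdx nt → ℤ, (∑ k, (d k : ℝ) ^ 2)⁻¹ ^ (nt + 1) with hS
  have hS0 : 0 ≤ S := tsum_nonneg fun d => by positivity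
  have hM0 : 0 ≤ M := by positivity
  refine ⟨κ / (2 * (1 + M * S)), max 1 (2 * (1 + M * S) / κ), by positivity, by positivity,
    fun nr hnr rx hrx => rx.worstLayerBound_of_le (by omega) hκ (by nlinarith [mul_nonneg hM0 hS0])
      fun P hP s => ?_⟩
  have hP0 : 0 < P := by linarith
  refine (h nr q rx hq hrx s P hP0).trans
    ((tsum_le_of_le_inv_pow (nt := nt) (nr := nr) (x := κ * P) (M := M) (by positivity) hM0 _
      fun d => ?_).trans (ENNReal.ofReal_le_ofReal ?_))
  · have hX := one_le_sum_sq_of_ne_zero d.2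
    set X := ∑ k, (d.1 k : ℝ) ^ 2
    have hX0 : 0 < X := by linarith
    have h1 : 3 * Real.exp (-a * X) ≤ M * X⁻¹ ^ (nt + 1) := by
      have h2 := Real.pow_div_factorial_le_exp (a * X) (by positivity) (nt + 1)
      have h3 : Real.exp (-a * X) ≤ ((a * X) ^ (nt + 1) / (nt + 1).factorial)⁻¹ := by
        rw [neg_mul, Real.exp_neg]
        exact inv_anti₀ (by positivity) h2
      refine (mul_le_mul_of_nonneg_left h3 (by norm_num)).trans_eq ?_
      rw [hM, inv_div, mul_pow, inv_pow, mul_assoc, div_mul_eq_div_div]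
      rfl
    have h4 : (1 / (1 + κ * P * X)) ^ nr ≤ (1 / (1 + κ * P)) ^ nr := by
      refine pow_le_pow_left₀ (by positivity) (one_div_le_one_div_of_le (by positivity) ?_) nr
      have := le_mul_of_one_le_right (by positivity : 0 ≤ κ * P) hX
      linarith
    exact mul_le_mul h1 h4 (by positivity) (by positivity)
  · gcongr
    linarith

/-- The layer bound with constants independent of the constellation. -/
theorem exists_worstLayerBound_uniform {nt : ℕ} (hnt : 0 < nt) :
    ∃ c P₀ : ℝ, 0 < c ∧ 0 < P₀ ∧ ∀ nr : ℕ, (nt < nr ∨ nt = 1 ∧ nr = 1) → ∀ q : ℕ, 1 < q →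
      ∀ rx : Receiver nt nr, rx.IsIntegerForcing q → rx.WorstLayerBound q c P₀ := by
  obtain ⟨κ, hκ, h, h'⟩ := exists_worstLayerError_le hnt
  set M : ℝ := 3 * 2 ^ (nt + 1) with hM
  set S := ∑' d : RealIdx nt → ℤ, (∑ k, (d k : ℝ) ^ 2)⁻¹ ^ (nt + 1) with hS
  have hS0 : 0 ≤ S := tsum_nonneg fun d => by positivity
  have hM0 : 0 ≤ M := by positivity
  have hMS := mul_nonneg hM0 hS0
  refine ⟨κ / (2 * (3 + M * S)), max (1 / κ) (2 * (3 + M * S) / κ), by positivity, by positivity,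
    fun nr hnr q hq rx hrx => rx.worstLayerBound_of_le (by omega) hκ (by linarith)
      fun P hP s => ?_⟩
  have hP0 : 0 < P := lt_of_lt_of_le (by positivity) hP
  have hκP : 1 ≤ κ * P := by
    rw [div_le_iff₀ hκ] at hP
    linarith
  rcases hnr with hnr | ⟨hnt1, hnr1⟩
  · have hE := avgEnergy_pos hq
    refine (h nr q rx hq hrx s P hP0).trans
      ((tsum_le_of_le_inv_pow (nt := nt) (nr := nr) (x := κ * P) (M := M) (by positivity) hM0 _
        fun d => ?_).trans (ENNReal.ofReal_le_ofReal ?_))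
    · have hX := one_le_sum_sq_of_ne_zero d.2
      set X := ∑ k, (d.1 k : ℝ) ^ 2
      have hX0 : 0 < X := by linarith
      have h1 : Real.exp (-(κ / avgEnergy q) * X) ≤ 1 := by
        rw [Real.exp_le_one_iff, neg_mul, neg_nonpos]
        positivity
      -- The loss relative to a unit vector: `ρ ≤ 1` allows lowering the exponent from `nr` to `nt +
      -- 1`, and `ρ ≤ 2 / X`, valid as `κ * P ≥ 1`, gives summability uniformly in `P` and `nr`.
      set ρ := (1 + κ * P) / (1 + κ * P * X) with hρ
      have hρ0 : 0 < ρ := by positivity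
      have hρ1 : ρ ≤ 1 := by
        rw [hρ, div_le_one (by positivity)]
        have := le_mul_of_one_le_right (by positivity : 0 ≤ κ * P) hX
        linarith
      have hρ2 : ρ ≤ 2 * X⁻¹ := by
        rw [hρ, ← div_eq_mul_inv, div_le_div_iff₀ (by positivity) hX0]
        nlinarith
      have h2 : ρ ^ nr ≤ (2 * X⁻¹) ^ (nt + 1) :=
        (pow_le_pow_of_le_one hρ0.le hρ1 hnr).trans (pow_le_pow_left₀ hρ0.le hρ2 _)
      have h3 : 1 / (1 + κ * P * X) = ρ * (1 / (1 + κ * P)) := by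
        rw [hρ]; field_simp
      rw [h3, mul_pow]
      calc _ ≤ 3 * 1 * ((2 * X⁻¹) ^ (nt + 1) * (1 / (1 + κ * P)) ^ nr) := by gcongr
        _ = _ := by rw [mul_pow]; ring
    · gcongr
      linarith
  · subst hnr1
    refine (h' q rx hnt1 hq hrx s P hP0).trans (ENNReal.ofReal_le_ofReal ?_)
    gcongr
    linarith

/-! ### From the worst layer to the whole receiver -/

theorem Receiver.WorstLayerBound.layerBound {nt nr q : ℕ} {rx : Receiver nt nr} {c P₀ : ℝ}
    (h : rx.WorstLayerBound q c P₀) : rx.LayerBound q c P₀ := fun P hP s m =>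
  (lintegral_mono fun H => le_iSup (fun m => noiseLaw nr
    {Z | rx.latticeOutput P H s Z m ≠ rx.target P H s m}) m).trans (h P hP s)

theorem Receiver.latticeError_le {nt nr q : ℕ} (rx : Receiver nt nr) (s : Symbols nt q) (P : ℝ) :
    rx.latticeError s P ≤ (2 * nt : ℕ) * rx.worstLayerError s P := by
  rw [Receiver.worstLayerError, ← lintegral_const_mul' _ _ (ENNReal.natCast_ne_top _)]
  refine lintegral_mono fun H => ?_
  have hsub : {Z | rx.latticeOutput P H s Z ≠ rx.target P H s} ⊆
      ⋃ m, {Z | rx.latticeOutput P H s Z m ≠ rx.target P H s m} := fun Z hZ => by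
    obtain ⟨m, hm⟩ := Function.ne_iff.1 hZ
    exact Set.mem_iUnion.2 ⟨m, hm⟩
  refine (measure_mono hsub).trans ((measure_iUnion_fintype_le _ _).trans ?_)
  refine (Finset.sum_le_card_nsmul _ _ _ fun m _ => le_iSup (fun m => noiseLaw nr
    {Z | rx.latticeOutput P H s Z m ≠ rx.target P H s m}) m).trans_eq ?_
  simp [two_mul]

/-- If every layer is correct, invertibility of `A` modulo `q` recovers the symbols exactly. -/
theorem Receiver.symbolError_le_latticeError {nt nr q : ℕ} (rx : Receiver nt nr)
    (hrx : rx.IsIntegerForcing q) (s : Symbols nt q) {P : ℝ} (hP : 0 < P) :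
    rx.symbolError s P ≤ rx.latticeError s P := by
  refine lintegral_mono_ae ?_
  filter_upwards [hrx P hP] with H hH
  refine measure_mono fun Z hZ hout => hZ ?_
  have h1 : (fun m => (rx.latticeOutput P H s Z m : ZMod q)) =
      modMatrix q (rx.A P H) *ᵥ fun k => ((s k : ℕ) : ZMod q) := by
    ext m
    rw [hout]
    simp [Receiver.target, Matrix.mulVec, dotProduct, modMatrix]
  rw [Receiver.decoded, h1, Matrix.mulVec_mulVec,
    Matrix.nonsing_inv_mul _ ((Matrix.isUnit_iff_isUnit_det _).1 hH.1), Matrix.one_mulVec]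

theorem Receiver.WorstLayerBound.hasDiversity {nt nr q : ℕ} (hnt : 0 < nt) {rx : Receiver nt nr}
    {c P₀ : ℝ} (hc : 0 < c) (hP₀ : 0 < P₀) (hrx : rx.IsIntegerForcing q)
    (h : rx.WorstLayerBound q c P₀) (s : Symbols nt q) :
    HasDiversity (rx.latticeError s) nr ∧ HasDiversity (rx.symbolError s) nr := by
  have hnt' : (0 : ℝ) < nt := by exact_mod_cast hnt
  have hlat : ∀ P, P₀ ≤ P →
      rx.latticeError s P ≤ ENNReal.ofReal (2 * nt / c ^ nr / P ^ nr) := fun P hP => by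
    have hP0 : 0 < P := hP₀.trans_le hP
    refine (rx.latticeError_le s P).trans ((mul_le_mul_right (h P hP s) _).trans ?_)
    rw [← ENNReal.ofReal_natCast, ← ENNReal.ofReal_mul (by positivity)]
    refine ENNReal.ofReal_le_ofReal ?_
    rw [div_div, ← mul_pow, one_div, inv_pow, ← div_eq_mul_inv]
    push_cast
    gcongr
    linarith
  exact ⟨⟨_, P₀, by positivity, hP₀, hlat⟩, ⟨_, P₀, by positivity, hP₀, fun P hP =>
    (rx.symbolError_le_latticeError hrx s (hP₀.trans_le hP)).trans (hlat P hP)⟩⟩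

end VBLAST

theorem theorem2 (nt : ℕ) (hnt : 0 < nt) :
    (∀ nr : ℕ, nt ≤ nr → ∀ k : ℕ, 0 < k → ∀ rx : VBLAST.Receiver nt nr,
      rx.IsIntegerForcing (2 ^ k) → ∀ s : VBLAST.Symbols nt (2 ^ k),
        VBLAST.HasDiversity (rx.latticeError s) nr ∧
        VBLAST.HasDiversity (rx.symbolError s) nr) ∧
    (∀ k : ℕ, 0 < k → ∃ c P₀ : ℝ, 0 < c ∧ 0 < P₀ ∧
      ∀ nr : ℕ, nt ≤ nr → ∀ rx : VBLAST.Receiver nt nr,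
        rx.IsIntegerForcing (2 ^ k) → rx.LayerBound (2 ^ k) c P₀) ∧
    (∃ c P₀ : ℝ, 0 < c ∧ 0 < P₀ ∧
      ∀ nr : ℕ, (nt < nr ∨ nt = 1 ∧ nr = 1) → ∀ k : ℕ, 0 < k → ∀ rx : VBLAST.Receiver nt nr,
        rx.IsIntegerForcing (2 ^ k) → rx.LayerBound (2 ^ k) c P₀) := by
  have hq : ∀ k : ℕ, 0 < k → 1 < 2 ^ k := fun k hk => Nat.one_lt_two_pow hk.ne'
  refine ⟨fun nr hnr k hk rx hrx s => ?_, fun k hk => ?_, ?_⟩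
  · obtain ⟨c, P₀, hc, hP₀, h⟩ := VBLAST.exists_worstLayerBound hnt (hq k hk)
    exact (h nr hnr rx hrx).hasDiversity hnt hc hP₀ hrx s
  · obtain ⟨c, P₀, hc, hP₀, h⟩ := VBLAST.exists_worstLayerBound hnt (hq k hk)
    exact ⟨c, P₀, hc, hP₀, fun nr hnr rx hrx => (h nr hnr rx hrx).layerBound⟩
  · obtain ⟨c, P₀, hc, hP₀, h⟩ := VBLAST.exists_worstLayerBound_uniform hnt
    exact ⟨c, P₀, hc, hP₀, fun nr hnr k hk rx hrx => (h nr hnr _ (hq k hk) rx hrx).layerBound⟩
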